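/- Let $N\ge 1$, let $\Omega\subseteq\mathbb{R}^N$ be a bounded open set (no regularity of $\partial\Omega$ and no connectedness is assumed), let $1<p<\infty$ and let $p'=p/(p-1)$. Let $W^{1,p}(\Omega)$ be the usual Sobolev space, for $1<s<\infty$ let $W^{1,s}_0(\Omega)$ be the closure of $C^\infty_c(\Omega)$ in $W^{1,s}(\Omega)$, and set $$W^{1,p_-}_0(\Omega)=W^{1,p}(\Omega)\cap\bigcap_{1<s<p}W^{1,s}_0(\Omega).$$ Then: (a) for every $z\in L^{p'}(\Omega)$ and $Z\in L^{p'}(\Omega;\mathbb{R}^N)$ there exists one and only one $w\in W^{1,p_-}_0(\Omega)$ such that $$\int_\Omega|\nabla w|^{p-2}\nabla w\cdot\nabla v\,dx=\int_\Omega(zv+Z\cdot\nabla v)\,dx\qquad\text{for all }v\in W^{1,p_-}_0(\Omega),$$ and the map $L^{p'}(\Omega)\times L^{p'}(\Omega;\mathbb{R}^N)\to W^{1,p}(\Omega)$, $(z,Z)\mapsto w$, is continuous; (b) if $z_1,z_2\in L^{p'}(\Omega)$ satisfy $z_1\le z_2$ a.e. in $\Omega$ and $w_1,w_2\in W^{1,p_-}_0(\Omega)$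 are the solutions of $$\int_\Omega|\nabla w_k|^{p-2}\nabla w_k\cdot\nabla v\,dx=\int_\Omega z_kv\,dx\qquad\text{for all }v\in W^{1,p_-}_0(\Omega),\quad k=1,2,$$ then $w_1\le w_2$ a.e. in $\Omega$. -/

import Mathlib

open MeasureTheory
open scoped ENNReal ContDiff

/-- `φ ∈ C_c^∞(Ω)`. -/
def IsTestFunction {N : ℕ} (Ω : Set (EuclideanSpace ℝ (Fin N)))
    (φ : EuclideanSpace ℝ (Fin N) → ℝ) : Prop :=
  ContDiff ℝ ∞ φ ∧ HasCompactSupport φ ∧ tsupport φ ⊆ Ω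

/-- `g` is the weak (distributional) gradient of `u` in `Ω`. It is only used for `u`, `g` in
Lebesgue spaces over a set of finite measure, where both integrands are integrable. -/
def IsWeakGradient {N : ℕ} (Ω : Set (EuclideanSpace ℝ (Fin N)))
    (u : EuclideanSpace ℝ (Fin N) → ℝ)
    (g : EuclideanSpace ℝ (Fin N) → EuclideanSpace ℝ (Fin N)) : Prop :=
  ∀ φ, IsTestFunction Ω φ →
    ∫ x in Ω, u x • gradient φ x = - ∫ x in Ω, φ x • g x

/-- The ambient space `L^p(Ω) × L^p(Ω; ℝ^N)` of pairs (function, vector field). -/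
abbrev LpPair {N : ℕ} (Ω : Set (EuclideanSpace ℝ (Fin N))) (p : ℝ≥0∞) : Type :=
  Lp ℝ p (volume.restrict Ω) × Lp (EuclideanSpace ℝ (Fin N)) p (volume.restrict Ω)

/-- The Sobolev space `W^{1,p}(Ω)`: a function `u ∈ L^p(Ω)` with weak gradient in `L^p(Ω; ℝ^N)` is
recorded as the pair `(u, ∇u)`; the second component is determined by the first. For `1 ≤ p` the
topology inherited from `LpPair` is that of the norm `max ‖u‖_p ‖∇u‖_p`, which is equivalent to
the usual Sobolev norm. -/
def W1p {N : ℕ} (Ω : Set (EuclideanSpace ℝ (Fin N))) (p : ℝ≥0∞) : Set (LpPair Ω p) :=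
  {u | IsWeakGradient Ω u.1 u.2}

/-- `W^{1,p}_0(Ω)`: the closure of `C_c^∞(Ω)` in the Sobolev norm. -/
def W1pZero {N : ℕ} (Ω : Set (EuclideanSpace ℝ (Fin N))) (p : ℝ≥0∞) [Fact (1 ≤ p)] :
    Set (LpPair Ω p) :=
  closure {u | ∃ φ, IsTestFunction Ω φ ∧
    (∀ᵐ x ∂(volume.restrict Ω), u.1 x = φ x) ∧
    (∀ᵐ x ∂(volume.restrict Ω), u.2 x = gradient φ x)}

/-- `W^{1,p_-}_0(Ω) = W^{1,p}(Ω) ∩ ⋂_{1 < s < p} W^{1,s}_0(Ω)`: the functions in `W^{1,p}(Ω)` that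
coincide a.e. with an element of `W^{1,s}_0(Ω)`, for every `1 < s < p`. -/
def W1pMinus {N : ℕ} (Ω : Set (EuclideanSpace ℝ (Fin N))) (p : ℝ≥0∞) : Set (LpPair Ω p) :=
  {u | u ∈ W1p Ω p ∧ ∀ (s : ℝ≥0∞) [Fact (1 ≤ s)], 1 < s → s < p →
    ∃ y ∈ W1pZero Ω s, ∀ᵐ x ∂(volume.restrict Ω), y.1 x = u.1 x}

/-- `w` solves, in `W^{1,p_-}_0(Ω)`, the weak `p`-Laplace equation
`∫ |∇w|^{p-2} ∇w · ∇v = ∫ (z v + Z · ∇v)` for all `v ∈ W^{1,p_-}_0(Ω)`. -/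
def IsWeakSolution {N : ℕ} (Ω : Set (EuclideanSpace ℝ (Fin N))) (p : ℝ≥0∞)
    (z : EuclideanSpace ℝ (Fin N) → ℝ)
    (Z : EuclideanSpace ℝ (Fin N) → EuclideanSpace ℝ (Fin N)) (w : LpPair Ω p) : Prop :=
  w ∈ W1pMinus Ω p ∧ ∀ v ∈ W1pMinus Ω p,
    ∫ x in Ω, ‖w.2 x‖ ^ (p.toReal - 2) * inner ℝ (w.2 x) (v.2 x) =
      ∫ x in Ω, (z x * v.1 x + inner ℝ (Z x) (v.2 x))

/-! Write X for W^{1,p_-}_0(Ω), realised as pairs (u, ∇u) inside L^p × L^p. The equation is the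
Euler–Lagrange equation on X of J(w) = ‖∇w‖_p^p / p - ℓ(w), where ℓ is the continuous functional
given by (z, Z). Two facts about X suffice for part (a): it is closed, and a Poincaré inequality ‖u‖
≤ K ‖∇u‖_p holds on it.

Both facts come from the exponents s < p. Because weak gradients are unique, u lies in X exactly
when (u, ∇u) is, for every s in (1, p), an L^s limit of pairs (φ, ∇φ) with φ a test function
(`mem_W1pMinus_iff`). Since Ω has finite measure, L^p convergence implies L^s convergence, so X is
closed. Poincaré's inequality for test functions has constant sR, which stays bounded as s increases
to p, and Fatou's lemma carries it to the exponent p (`lpNorm_le_of_forall_lt`). Test functions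
extend by zero, so the boundary of Ω plays no role.

The analytic engine is a uniform convexity estimate for |a|^q valid for all q > 1
(`exists_norm_sub_rpow_le`): |a - b|^q is at most a small multiple of |a|^q + |b|^q plus a constant
times the midpoint convexity defect. Integrated over Ω, it shows that minimizing sequences of J are
Cauchy, which gives existence without weak compactness. The defect is also controlled by the
monotonicity of the flux, which gives stability in ℓ and hence uniqueness and continuity.

For part (b), X is stable under positive parts, by the chain rule at each s < p. Testing the
difference of the equations with (w₁ - w₂)⁺ forces its gradient to vanish, and Poincaré's inequality
finishes. -/

/-! ### Convexity of |a|^q in an inner product space -/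

section Pointwise

variable {V : Type*} [NormedAddCommGroup V] [InnerProductSpace ℝ V] {q : ℝ}

/-- The vector field `a ↦ |a|^{q-2} a`, i.e. the gradient of `|a|^q / q`. -/
noncomputable def powFlux (q : ℝ) (a : V) : V := ‖a‖ ^ (q - 2) • a

lemma norm_powFlux (hq : 1 < q) (a : V) : ‖powFlux q a‖ = ‖a‖ ^ (q - 1) := by
  rcases eq_or_ne a 0 with rfl | ha
  · simp [powFlux, Real.zero_rpow (by linarith : q - 1 ≠ 0)]
  · have h : 0 < ‖a‖ := norm_pos_iff.2 ha
    rw [powFlux, norm_smul, Real.norm_of_nonneg (by positivity)]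
    nth_rewrite 2 [← Real.rpow_one ‖a‖]
    rw [← Real.rpow_add h]
    ring_nf

lemma inner_powFlux_self (hq : 1 < q) (a : V) : inner ℝ (powFlux q a) a = ‖a‖ ^ q := by
  rcases eq_or_ne a 0 with rfl | ha
  · simp [Real.zero_rpow (by linarith : q ≠ 0)]
  · have h : 0 < ‖a‖ := norm_pos_iff.2 ha
    rw [powFlux, real_inner_smul_left, real_inner_self_eq_norm_sq, ← Real.rpow_natCast,
      ← Real.rpow_add h]
    norm_num

lemma continuous_powFlux (hq : 1 < q) : Continuous (powFlux q : V → V) := by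
  rw [continuous_iff_continuousAt]
  intro a
  rcases eq_or_ne a 0 with rfl | ha
  · have h0 : powFlux q (0 : V) = 0 := by simp [powFlux]
    rw [ContinuousAt, h0, tendsto_zero_iff_norm_tendsto_zero]
    simp_rw [norm_powFlux hq]
    have : ContinuousAt (fun x : V => ‖x‖ ^ (q - 1)) 0 :=
      continuous_norm.continuousAt.rpow_const (Or.inr (by linarith))
    simpa [ContinuousAt, Real.zero_rpow (by linarith : q - 1 ≠ 0)] using this
  · exact (continuous_norm.continuousAt.rpow_const (Or.inl (by simpa using ha))).smul
      continuousAt_id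

/-- Convexity of `|a|^q` in gradient form. -/
lemma mul_inner_powFlux_sub_le (hq : 1 < q) (a b : V) :
    q * inner ℝ (powFlux q a) (b - a) ≤ ‖b‖ ^ q - ‖a‖ ^ q := by
  have hc : (q / (q - 1)).HolderConjugate q := (Real.HolderConjugate.conjExponent hq).symm
  have hq1 : 0 < q - 1 := by linarith
  have h1 : inner ℝ (powFlux q a) b ≤ ‖a‖ ^ (q - 1) * ‖b‖ := by
    rw [← norm_powFlux hq]; exact real_inner_le_norm _ _
  have h2 := Real.young_inequality_of_nonneg (a := ‖a‖ ^ (q - 1)) (b := ‖b‖)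
    (by positivity) (by positivity) hc
  rw [← Real.rpow_mul (norm_nonneg a), mul_div_cancel₀ _ hq1.ne'] at h2
  have h3 : q * (‖a‖ ^ q / (q / (q - 1)) + ‖b‖ ^ q / q) = (q - 1) * ‖a‖ ^ q + ‖b‖ ^ q := by
    field_simp
  have h4 := mul_le_mul_of_nonneg_left (h1.trans h2) (by linarith : 0 ≤ q)
  rw [inner_sub_right, inner_powFlux_self hq]
  linarith

/-- The defect of midpoint convexity of `|a|^q`. -/
noncomputable def powDefect (q : ℝ) (a b : V) : ℝ :=
  (‖a‖ ^ q + ‖b‖ ^ q) / 2 - ‖(1 / 2 : ℝ) • (a + b)‖ ^ q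

/-- Add the gradient inequalities based at a and at b, both evaluated at the midpoint. This is how
monotonicity of the flux controls the convexity defect. -/
lemma powDefect_le (hq : 1 < q) (a b : V) :
    powDefect q a b ≤ q / 4 * inner ℝ (powFlux q a - powFlux q b) (a - b) := by
  have ha := mul_inner_powFlux_sub_le hq a ((1 / 2 : ℝ) • (a + b))
  have hb := mul_inner_powFlux_sub_le hq b ((1 / 2 : ℝ) • (a + b))
  have e1 : (1 / 2 : ℝ) • (a + b) - a = (1 / 2 : ℝ) • (b - a) := by module
  have e2 : (1 / 2 : ℝ) • (a + b) - b = (1 / 2 : ℝ) • (a - b) := by module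
  rw [e1, real_inner_smul_right, inner_sub_right] at ha
  rw [e2, real_inner_smul_right, inner_sub_right] at hb
  rw [powDefect, inner_sub_left, inner_sub_right, inner_sub_right]
  linarith

/-- Strict convexity of t ↦ t^q first forces |a| = |b|; then strict convexity of the Euclidean ball
forces a = b. -/
lemma powDefect_nonneg_and_eq (hq : 1 < q) (a b : V) :
    0 ≤ powDefect q a b ∧ (powDefect q a b = 0 → a = b) := by
  have hm : ‖(1 / 2 : ℝ) • (a + b)‖ ≤ (1 / 2 : ℝ) * ‖a‖ + (1 / 2 : ℝ) * ‖b‖ := by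
    rw [norm_smul, ← mul_add, Real.norm_of_nonneg (by norm_num)]
    gcongr
    exact norm_add_le a b
  have hm' := Real.rpow_le_rpow (norm_nonneg _) hm (by linarith : 0 ≤ q)
  have hconv := (strictConvexOn_rpow hq).convexOn.2 (Set.mem_Ici.2 (norm_nonneg a))
    (Set.mem_Ici.2 (norm_nonneg b)) (by norm_num : (0 : ℝ) ≤ 1 / 2)
    (by norm_num : (0 : ℝ) ≤ 1 / 2) (by norm_num)
  simp only [smul_eq_mul] at hconv
  refine ⟨by rw [powDefect]; linarith, fun h => ?_⟩
  rw [powDefect] at h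
  have hab : ‖a‖ = ‖b‖ := by
    by_contra hne
    have := (strictConvexOn_rpow hq).2 (Set.mem_Ici.2 (norm_nonneg a))
      (Set.mem_Ici.2 (norm_nonneg b)) hne (by norm_num : (0 : ℝ) < 1 / 2)
      (by norm_num : (0 : ℝ) < 1 / 2) (by norm_num)
    simp only [smul_eq_mul] at this
    linarith
  have hpow : ‖(1 / 2 : ℝ) • (a + b)‖ ^ q = ‖a‖ ^ q := by rw [hab] at h ⊢; linarith
  have hn : ‖(1 / 2 : ℝ) • (a + b)‖ = ‖a‖ :=
    (Real.rpow_left_inj (norm_nonneg _) (norm_nonneg _) (by linarith)).1 hpow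
  by_contra hne
  have := norm_combo_lt_of_ne (le_refl ‖a‖) hab.ge hne (by norm_num : (0 : ℝ) < 1 / 2)
    (by norm_num : (0 : ℝ) < 1 / 2) (by norm_num)
  rw [← smul_add] at this
  exact absurd hn this.ne

lemma powDefect_nonneg (hq : 1 < q) (a b : V) : 0 ≤ powDefect q a b :=
  (powDefect_nonneg_and_eq hq a b).1

lemma continuous_powDefect (hq : 1 < q) :
    Continuous fun x : V × V => powDefect q x.1 x.2 := by
  have h0 : 0 ≤ q := by linarith
  unfold powDefect
  exact (((continuous_fst.norm.rpow_const fun _ => Or.inr h0).add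
    (continuous_snd.norm.rpow_const fun _ => Or.inr h0)).div_const 2).sub
    (((continuous_fst.add continuous_snd).const_smul _).norm.rpow_const fun _ => Or.inr h0)

lemma norm_smul_rpow {t : ℝ} (ht : 0 ≤ t) (a : V) : ‖t • a‖ ^ q = t ^ q * ‖a‖ ^ q := by
  rw [norm_smul, Real.norm_of_nonneg ht, Real.mul_rpow ht (norm_nonneg _)]

lemma powDefect_smul {t : ℝ} (ht : 0 ≤ t) (a b : V) :
    powDefect q (t • a) (t • b) = t ^ q * powDefect q a b := by
  rw [powDefect, ← smul_add, smul_comm, norm_smul_rpow ht, norm_smul_rpow ht, norm_smul_rpow ht,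
    powDefect]
  ring

/-- Uniform convexity of `|a|^q`, for all `1 < q < ∞` at once. -/
lemma exists_norm_sub_rpow_le [FiniteDimensional ℝ V] (hq : 1 < q) {ε : ℝ} (hε : 0 < ε) :
    ∃ C : ℝ, 0 ≤ C ∧ ∀ a b : V,
      ‖a - b‖ ^ q ≤ ε * (‖a‖ ^ q + ‖b‖ ^ q) + C * powDefect q a b := by
  have hq0 : 0 < q := by linarith
  have : ProperSpace V := FiniteDimensional.proper ℝ V
  -- Pairs on the unit sphere that stay apart. This set is compact in finite dimension and the
  -- defect is positive on it, so the defect has a positive lower bound δ there.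
  let K : Set (V × V) := {x | ‖x‖ = 1 ∧ ε ≤ ‖x.1 - x.2‖ ^ q}
  have hKc : IsCompact K := by
    refine (isCompact_sphere (0 : V × V) 1).of_isClosed_subset ?_ ?_
    · have hc : Continuous fun x : V × V => ‖x.1 - x.2‖ ^ q :=
        (continuous_fst.sub continuous_snd).norm.rpow_const fun _ => Or.inr hq0.le
      exact (isClosed_eq continuous_norm continuous_const).inter (isClosed_le continuous_const hc)
    · rintro x ⟨hx, -⟩
      simpa using hx
  have hδ : ∃ δ : ℝ, 0 < δ ∧ ∀ x ∈ K, δ ≤ powDefect q x.1 x.2 := by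
    rcases K.eq_empty_or_nonempty with hK | hK
    · exact ⟨1, one_pos, by simp [hK]⟩
    · obtain ⟨x, hx, hmin⟩ := hKc.exists_isMinOn hK (continuous_powDefect hq).continuousOn
      refine ⟨_, ?_, fun y hy => hmin hy⟩
      refine lt_of_le_of_ne (powDefect_nonneg hq _ _) fun h => ?_
      have := (powDefect_nonneg_and_eq hq _ _).2 h.symm
      have h2 := hx.2
      rw [this, sub_self, norm_zero, Real.zero_rpow hq0.ne'] at h2
      linarith
  obtain ⟨δ, hδ, hK⟩ := hδ
  -- On `K` the defect is at least δ while |a - b| ≤ 2. Off `K` the ε-term alone suffices, since in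
  -- the max norm one of |a|, |b| equals 1.
  refine ⟨2 ^ q / δ, by positivity, fun a b => ?_⟩
  rcases eq_or_ne (a, b) 0 with h0 | h0
  · obtain ⟨rfl, rfl⟩ : a = 0 ∧ b = 0 := by simpa using h0
    simp [Real.zero_rpow hq0.ne', powDefect]
  have key : ∀ x : V × V, ‖x‖ = 1 →
      ‖x.1 - x.2‖ ^ q ≤ ε * (‖x.1‖ ^ q + ‖x.2‖ ^ q) + 2 ^ q / δ * powDefect q x.1 x.2 := by
    intro x hx
    have hone : 1 ≤ ‖x.1‖ ^ q + ‖x.2‖ ^ q := by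
      have p1 : 0 ≤ ‖x.1‖ ^ q := by positivity
      have p2 : 0 ≤ ‖x.2‖ ^ q := by positivity
      rw [Prod.norm_def] at hx
      rcases max_choice ‖x.1‖ ‖x.2‖ with h | h <;> rw [h] at hx <;> rw [hx, Real.one_rpow] <;>
        linarith
    have hD := powDefect_nonneg hq x.1 x.2
    by_cases hx2 : ε ≤ ‖x.1 - x.2‖ ^ q
    · have hd := hK x ⟨hx, hx2⟩
      have h2 : ‖x.1 - x.2‖ ≤ 2 := by
        have := norm_sub_le x.1 x.2
        have := norm_fst_le x
        have := norm_snd_le x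
        linarith
      have h3 : ‖x.1 - x.2‖ ^ q ≤ 2 ^ q := Real.rpow_le_rpow (norm_nonneg _) h2 hq0.le
      have h4 : (2 : ℝ) ^ q ≤ 2 ^ q / δ * powDefect q x.1 x.2 := by
        rw [div_mul_eq_mul_div, le_div_iff₀ hδ]
        gcongr
      have : 0 ≤ ε * (‖x.1‖ ^ q + ‖x.2‖ ^ q) := by positivity
      linarith
    · push Not at hx2
      have : ε * 1 ≤ ε * (‖x.1‖ ^ q + ‖x.2‖ ^ q) := by gcongr
      have : 0 ≤ 2 ^ q / δ * powDefect q x.1 x.2 := by positivity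
      linarith
  -- All terms are homogeneous of degree q, so the estimate on the unit sphere scales to every pair.
  set t := ‖(a, b)‖ with ht
  have htpos : 0 < t := norm_pos_iff.2 h0
  have := key (t⁻¹ • (a, b)) (by rw [norm_smul, norm_inv, norm_norm]; exact inv_mul_cancel₀ htpos.ne')
  have hi : 0 ≤ t⁻¹ := by positivity
  simp only [Prod.smul_fst, Prod.smul_snd, ← smul_sub] at this
  rw [powDefect_smul hi, norm_smul_rpow hi, norm_smul_rpow hi, norm_smul_rpow hi] at this
  have hp : 0 < t⁻¹ ^ q := by positivity
  refine le_of_mul_le_mul_left ?_ hp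
  linarith

end Pointwise

/-! ### Integrated versions in L^p -/

section LpForms

variable {α V : Type*} [MeasurableSpace α] {μ : Measure α} [NormedAddCommGroup V]
  {p : ℝ≥0∞}

lemma one_lt_toReal_of_ne_top (hp : 1 < p) (hp_top : p ≠ ⊤) : 1 < p.toReal := by
  rwa [← ENNReal.toReal_one, ENNReal.toReal_lt_toReal ENNReal.one_ne_top hp_top]

lemma Lp_norm_rpow_eq_integral (hp : 1 < p) (hp_top : p ≠ ⊤) (f : Lp V p μ) :
    ‖f‖ ^ p.toReal = ∫ x, ‖f x‖ ^ p.toReal ∂μ := by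
  have hq := one_lt_toReal_of_ne_top hp hp_top
  rw [Lp.norm_def, toReal_eLpNorm (Lp.aestronglyMeasurable f),
    lpNorm_eq_integral_norm_rpow_toReal (by positivity) hp_top (Lp.aestronglyMeasurable f),
    Real.rpow_inv_rpow (by positivity) (by positivity)]

lemma Lp_integrable_norm_rpow (hp : 1 < p) (hp_top : p ≠ ⊤) (f : Lp V p μ) :
    Integrable (fun x => ‖f x‖ ^ p.toReal) μ :=
  (Lp.memLp f).integrable_norm_rpow (by positivity) hp_top

variable [InnerProductSpace ℝ V]

/-- Replace the smaller of the two norms by the larger. The crude bound serves as an integrable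
majorant. -/
lemma norm_inner_powFlux_le {q : ℝ} (hq : 1 < q) (a b : V) :
    ‖inner ℝ (powFlux q a) b‖ ≤ ‖a‖ ^ q + ‖b‖ ^ q := by
  have h1 : ‖inner ℝ (powFlux q a) b‖ ≤ ‖a‖ ^ (q - 1) * ‖b‖ := by
    rw [← norm_powFlux hq]; exact norm_inner_le_norm _ _
  have key : ∀ m : ℝ, 0 ≤ m → m ^ (q - 1) * m = m ^ q := fun m hm => by
    nth_rewrite 2 [← Real.rpow_one m]
    rw [← Real.rpow_add' hm (by linarith)]
    ring_nf
  refine h1.trans ?_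
  rcases le_total ‖a‖ ‖b‖ with h | h
  · calc ‖a‖ ^ (q - 1) * ‖b‖ ≤ ‖b‖ ^ (q - 1) * ‖b‖ := by gcongr
      _ = ‖b‖ ^ q := key _ (norm_nonneg _)
      _ ≤ _ := by linarith [Real.rpow_nonneg (norm_nonneg a) q]
  · calc ‖a‖ ^ (q - 1) * ‖b‖ ≤ ‖a‖ ^ (q - 1) * ‖a‖ := by gcongr
      _ = ‖a‖ ^ q := key _ (norm_nonneg _)
      _ ≤ _ := by linarith [Real.rpow_nonneg (norm_nonneg b) q]

lemma integrable_inner_powFlux (hp : 1 < p) (hp_top : p ≠ ⊤) (f g : Lp V p μ) :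
    Integrable (fun x => inner ℝ (powFlux p.toReal (f x)) (g x)) μ := by
  have hq := one_lt_toReal_of_ne_top hp hp_top
  refine ((Lp_integrable_norm_rpow hp hp_top f).add (Lp_integrable_norm_rpow hp hp_top g)).mono'
    (((continuous_powFlux hq).comp_aestronglyMeasurable (Lp.aestronglyMeasurable f)).inner
      (Lp.aestronglyMeasurable g)) (.of_forall fun x => norm_inner_powFlux_le hq _ _)

/-- The weak form `(f, g) ↦ ∫ |f|^{p-2} f · g` of the `p`-Laplace operator. -/
noncomputable def fluxForm (f g : Lp V p μ) : ℝ := ∫ x, inner ℝ (powFlux p.toReal (f x)) (g x) ∂μ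

lemma fluxForm_self (hp : 1 < p) (hp_top : p ≠ ⊤) (f : Lp V p μ) :
    fluxForm f f = ‖f‖ ^ p.toReal := by
  have hq := one_lt_toReal_of_ne_top hp hp_top
  rw [fluxForm, Lp_norm_rpow_eq_integral hp hp_top]
  simp_rw [inner_powFlux_self hq]

lemma fluxForm_neg_right (f g : Lp V p μ) : fluxForm f (-g) = -fluxForm f g := by
  rw [fluxForm, fluxForm, ← integral_neg]
  refine integral_congr_ae ?_
  filter_upwards [Lp.coeFn_neg g] with x hx
  rw [hx, Pi.neg_apply, inner_neg_right]

lemma fluxForm_smul_right (c : ℝ) (f g : Lp V p μ) : fluxForm f (c • g) = c * fluxForm f g := by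
  rw [fluxForm, fluxForm, ← integral_const_mul]
  refine integral_congr_ae ?_
  filter_upwards [Lp.coeFn_smul c g] with x hx
  rw [hx, Pi.smul_apply, real_inner_smul_right]

lemma mul_fluxForm_sub_le (hp : 1 < p) (hp_top : p ≠ ⊤) [Fact (1 ≤ p)] (f g : Lp V p μ) :
    p.toReal * fluxForm f (g - f) ≤ ‖g‖ ^ p.toReal - ‖f‖ ^ p.toReal := by
  have hq := one_lt_toReal_of_ne_top hp hp_top
  rw [fluxForm, Lp_norm_rpow_eq_integral hp hp_top, Lp_norm_rpow_eq_integral hp hp_top,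
    ← integral_const_mul, ← integral_sub (Lp_integrable_norm_rpow hp hp_top _)
      (Lp_integrable_norm_rpow hp hp_top _)]
  refine integral_mono_ae ((integrable_inner_powFlux hp hp_top _ _).const_mul _)
    ((Lp_integrable_norm_rpow hp hp_top _).sub (Lp_integrable_norm_rpow hp hp_top _)) ?_
  filter_upwards [Lp.coeFn_sub g f] with x hx
  rw [hx]
  exact mul_inner_powFlux_sub_le hq _ _

lemma fluxForm_midpoint_bound (hp : 1 < p) (hp_top : p ≠ ⊤) [Fact (1 ≤ p)] (f g : Lp V p μ) :
    (‖f‖ ^ p.toReal + ‖g‖ ^ p.toReal) / 2 - ‖(1 / 2 : ℝ) • (f + g)‖ ^ p.toReal ≤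
      p.toReal / 4 * (fluxForm f (f - g) - fluxForm g (f - g)) := by
  have h1 := mul_fluxForm_sub_le hp hp_top f ((1 / 2 : ℝ) • (f + g))
  have h2 := mul_fluxForm_sub_le hp hp_top g ((1 / 2 : ℝ) • (f + g))
  have e1 : (1 / 2 : ℝ) • (f + g) - f = (-(1 / 2) : ℝ) • (f - g) := by module
  have e2 : (1 / 2 : ℝ) • (f + g) - g = (1 / 2 : ℝ) • (f - g) := by module
  rw [e1, fluxForm_smul_right] at h1
  rw [e2, fluxForm_smul_right] at h2
  linarith

/-- Uniform convexity of `‖f‖_p^p`. -/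
lemma exists_Lp_norm_sub_rpow_le [FiniteDimensional ℝ V] (hp : 1 < p) (hp_top : p ≠ ⊤)
    [Fact (1 ≤ p)] {ε : ℝ} (hε : 0 < ε) :
    ∃ C : ℝ, 0 ≤ C ∧ ∀ f g : Lp V p μ, ‖f - g‖ ^ p.toReal ≤
      ε * (‖f‖ ^ p.toReal + ‖g‖ ^ p.toReal) + C * ((‖f‖ ^ p.toReal + ‖g‖ ^ p.toReal) / 2
        - ‖(1 / 2 : ℝ) • (f + g)‖ ^ p.toReal) := by
  have hq := one_lt_toReal_of_ne_top hp hp_top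
  obtain ⟨C, hC, h⟩ := exists_norm_sub_rpow_le (V := V) hq hε
  refine ⟨C, hC, fun f g => ?_⟩
  have i := fun f : Lp V p μ => Lp_integrable_norm_rpow hp hp_top f
  have i1 : Integrable (fun x => ‖f x‖ ^ p.toReal + ‖g x‖ ^ p.toReal) μ := (i f).add (i g)
  have i2 : Integrable (fun x => (‖f x‖ ^ p.toReal + ‖g x‖ ^ p.toReal) / 2) μ := i1.div_const 2
  have i3 : Integrable (fun x => (‖f x‖ ^ p.toReal + ‖g x‖ ^ p.toReal) / 2 -
    ‖((1 / 2 : ℝ) • (f + g) : Lp V p μ) x‖ ^ p.toReal) μ := i2.sub (i _)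
  rw [Lp_norm_rpow_eq_integral hp hp_top f, Lp_norm_rpow_eq_integral hp hp_top g,
    Lp_norm_rpow_eq_integral hp hp_top (f - g), Lp_norm_rpow_eq_integral hp hp_top (_ • _),
    ← integral_add (i f) (i g), ← integral_const_mul, ← integral_div,
    ← integral_sub i2 (i _), ← integral_const_mul,
    ← integral_add (i1.const_mul _) (i3.const_mul _)]
  refine integral_mono_ae (i _) ((i1.const_mul _).add (i3.const_mul _)) ?_
  filter_upwards [Lp.coeFn_sub f g, Lp.coeFn_smul (1 / 2 : ℝ) (f + g), Lp.coeFn_add f g]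
    with x h1 h2 h3
  rw [h1, h2, Pi.smul_apply, h3]
  exact h (f x) (g x)

open Filter Topology in
-- Continuity of the flux along a segment is all the differentiability of the energy that the
-- Euler–Lagrange equation needs. As the step 1/(n+1) is at most 1, (|f| + |g|)^p + |g|^p dominates.
lemma tendsto_fluxForm_add_smul (hp : 1 < p) (hp_top : p ≠ ⊤) [Fact (1 ≤ p)] (f g : Lp V p μ) :
    Tendsto (fun n : ℕ => fluxForm (f + (1 / ((n : ℝ) + 1)) • g) g) atTop (𝓝 (fluxForm f g)) := by
  have hq := one_lt_toReal_of_ne_top hp hp_top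
  have hae : ∀ n : ℕ, fluxForm (f + (1 / ((n : ℝ) + 1)) • g) g =
      ∫ x, inner ℝ (powFlux p.toReal (f x + (1 / ((n : ℝ) + 1)) • g x)) (g x) ∂μ := by
    intro n
    refine integral_congr_ae ?_
    filter_upwards [Lp.coeFn_add f ((1 / ((n : ℝ) + 1)) • g),
      Lp.coeFn_smul (1 / ((n : ℝ) + 1)) g] with x h1 h2
    rw [h1, Pi.add_apply, h2, Pi.smul_apply]
  simp_rw [hae]
  have hmem : MemLp (fun x => ‖f x‖ + ‖g x‖) p μ := (Lp.memLp f).norm.add (Lp.memLp g).norm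
  refine tendsto_integral_of_dominated_convergence
    (fun x => ‖‖f x‖ + ‖g x‖‖ ^ p.toReal + ‖g x‖ ^ p.toReal) (fun n => ?_)
    ((hmem.integrable_norm_rpow (by positivity) hp_top).add (Lp_integrable_norm_rpow hp hp_top g))
    (fun n => .of_forall fun x => ?_) (.of_forall fun x => ?_)
  · exact ((continuous_powFlux hq).comp_aestronglyMeasurable ((Lp.aestronglyMeasurable f).add
      ((Lp.aestronglyMeasurable g).const_smul _))).inner (Lp.aestronglyMeasurable g)
  · refine (norm_inner_powFlux_le hq _ _).trans ?_
    gcongr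
    rw [Real.norm_of_nonneg (by positivity)]
    refine (norm_add_le _ _).trans ?_
    gcongr
    rw [norm_smul, Real.norm_of_nonneg (by positivity)]
    refine mul_le_of_le_one_left (norm_nonneg _) ?_
    rw [div_le_one (by positivity)]
    linarith [(Nat.cast_nonneg n : (0 : ℝ) ≤ n)]
  · have ht := tendsto_one_div_add_atTop_nhds_zero_nat (𝕜 := ℝ)
    have h2 : Tendsto (fun n : ℕ => f x + (1 / ((n : ℝ) + 1)) • g x) atTop (𝓝 (f x)) := by
      simpa using (ht.smul_const (g x)).const_add (f x)
    exact (((continuous_powFlux hq).tendsto _).comp h2).inner tendsto_const_nhds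

end LpForms

/-! ### Abstract existence, stability and uniqueness on a closed subspace with a Poincaré inequality
-/

section Minimization

/-- Coercivity: since q > 1, the power beats the linear term. It bounds minimizing sequences and
solutions. -/
lemma exists_forall_rpow_sub_le {q : ℝ} (hq : 1 < q) (L c : ℝ) (hL : 0 ≤ L) :
    ∃ M : ℝ, 0 ≤ M ∧ ∀ t : ℝ, 0 ≤ t → t ^ q / q - L * t ≤ c → t ≤ M := by
  have hA : 0 ≤ q * (L + |c| + 1) := by positivity
  -- Beyond this value t^(q-1) > q(L + |c| + 1), so t^q/q - Lt > (|c| + 1)t, and t > 1 makes this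
  -- exceed c.
  refine ⟨max 1 ((q * (L + |c| + 1)) ^ (q - 1)⁻¹), by positivity, fun t ht h => ?_⟩
  by_contra! hM
  obtain ⟨h1, h2⟩ := max_lt_iff.1 hM
  have h3 : q * (L + |c| + 1) < t ^ (q - 1) := by
    have := Real.rpow_lt_rpow (by positivity) h2 (by linarith : 0 < q - 1)
    rwa [Real.rpow_inv_rpow hA (by linarith)] at this
  have h4 : t ^ q = t ^ (q - 1) * t := by
    nth_rewrite 3 [← Real.rpow_one t]
    rw [← Real.rpow_add' ht (by linarith)]
    ring_nf
  have h5 : (L + |c| + 1) * t < t ^ q / q := by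
    rw [lt_div_iff₀ (by linarith), h4]
    calc _ = q * (L + |c| + 1) * t := by ring
      _ < _ := by gcongr
  have h6 := le_abs_self c
  have h7 := abs_nonneg c
  nlinarith

variable {α V : Type*} [MeasurableSpace α] {μ : Measure α} [NormedAddCommGroup V]
  [InnerProductSpace ℝ V] {p : ℝ≥0∞} [Fact (1 ≤ p)]

/-- `w ∈ X` solves `∫ |w₂|^{p-2} w₂ · v₂ = ℓ v` for all `v ∈ X`. -/
def SolvesFlux (X : Submodule ℝ (Lp ℝ p μ × Lp V p μ)) (ℓ : (Lp ℝ p μ × Lp V p μ) →L[ℝ] ℝ)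
    (w : Lp ℝ p μ × Lp V p μ) : Prop :=
  w ∈ X ∧ ∀ v ∈ X, fluxForm w.2 v.2 = ℓ v

variable {X : Submodule ℝ (Lp ℝ p μ × Lp V p μ)} {K : ℝ}

lemma apply_le_of_norm_le (hK : ∀ w ∈ X, ‖w‖ ≤ K * ‖w.2‖)
    (ℓ : (Lp ℝ p μ × Lp V p μ) →L[ℝ] ℝ) {w : Lp ℝ p μ × Lp V p μ} (hw : w ∈ X) :
    ℓ w ≤ ‖ℓ‖ * K * ‖w.2‖ := by
  calc ℓ w ≤ ‖ℓ w‖ := Real.le_norm_self _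
    _ ≤ ‖ℓ‖ * ‖w‖ := ℓ.le_opNorm w
    _ ≤ ‖ℓ‖ * (K * ‖w.2‖) := by gcongr; exact hK w hw
    _ = _ := by ring

/-- Minimality compares w with w + tv, and convexity based at w + tv bounds the energy increment by
t times the flux there. Dividing by t and letting t → 0 gives one inequality; replacing v by -v
gives the other. -/
lemma SolvesFlux.of_isMinOn (hp : 1 < p) (hp_top : p ≠ ⊤)
    {ℓ : (Lp ℝ p μ × Lp V p μ) →L[ℝ] ℝ} {w : Lp ℝ p μ × Lp V p μ} (hw : w ∈ X)
    (hmin : ∀ v ∈ X, ‖w.2‖ ^ p.toReal / p.toReal - ℓ w ≤ ‖v.2‖ ^ p.toReal / p.toReal - ℓ v) :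
    SolvesFlux X ℓ w := by
  have hq := one_lt_toReal_of_ne_top hp hp_top
  have hle : ∀ v ∈ X, ℓ v ≤ fluxForm w.2 v.2 := by
    intro v hv
    refine ge_of_tendsto' (tendsto_fluxForm_add_smul hp hp_top w.2 v.2) fun n => ?_
    set t : ℝ := 1 / ((n : ℝ) + 1)
    have ht : 0 < t := by positivity
    have h1 := hmin _ (X.add_mem hw (X.smul_mem t hv))
    have h2 := mul_fluxForm_sub_le hp hp_top (w.2 + t • v.2) w.2
    have e : w.2 - (w.2 + t • v.2) = (-t) • v.2 := by module
    rw [e, fluxForm_smul_right] at h2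
    rw [map_add, map_smul, Prod.snd_add, Prod.smul_snd, smul_eq_mul] at h1
    have h3 : ‖w.2 + t • v.2‖ ^ p.toReal / p.toReal - ‖w.2‖ ^ p.toReal / p.toReal ≤
        t * fluxForm (w.2 + t • v.2) v.2 := by
      rw [← sub_div, div_le_iff₀ (by linarith)]
      linarith
    refine le_of_mul_le_mul_left ?_ ht
    linarith
  refine ⟨hw, fun v hv => le_antisymm ?_ (hle v hv)⟩
  have := hle (-v) (X.neg_mem hv)
  rw [map_neg, Prod.snd_neg, fluxForm_neg_right] at this
  linarith

/-- Existence of weak solutions by minimization: minimizing sequences are Cauchy. -/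
theorem exists_solvesFlux [FiniteDimensional ℝ V] (hp : 1 < p) (hp_top : p ≠ ⊤)
    (hX : IsClosed (X : Set (Lp ℝ p μ × Lp V p μ))) (hK0 : 0 < K)
    (hK : ∀ w ∈ X, ‖w‖ ≤ K * ‖w.2‖) (ℓ : (Lp ℝ p μ × Lp V p μ) →L[ℝ] ℝ) :
    ∃ w, SolvesFlux X ℓ w := by
  have hq := one_lt_toReal_of_ne_top hp hp_top
  set q := p.toReal with hqdef
  have hq0 : 0 < q := by linarith
  let J : Lp ℝ p μ × Lp V p μ → ℝ := fun w => ‖w.2‖ ^ q / q - ℓ w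
  have hJ : ∀ w ∈ X, ‖w.2‖ ^ q / q - ‖ℓ‖ * K * ‖w.2‖ ≤ J w := fun w hw =>
    sub_le_sub_left (apply_le_of_norm_le hK ℓ hw) _
  have hL : 0 ≤ ‖ℓ‖ * K := by positivity
  have hbdd : BddBelow (J '' X) := by
    obtain ⟨M, hM0, hM⟩ := exists_forall_rpow_sub_le hq (‖ℓ‖ * K) 0 hL
    refine ⟨-(‖ℓ‖ * K * M), ?_⟩
    rintro _ ⟨w, hw, rfl⟩
    have h0 : 0 ≤ ‖ℓ‖ * K * M := by positivity
    by_cases h : J w ≤ 0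
    · have h1 := hM _ (norm_nonneg w.2) ((hJ w hw).trans h)
      have h2 : ‖ℓ‖ * K * ‖w.2‖ ≤ ‖ℓ‖ * K * M := by gcongr
      have h3 : 0 ≤ ‖w.2‖ ^ q / q := by positivity
      linarith [hJ w hw]
    · linarith
  set m := sInf (J '' X)
  have hm : ∀ w ∈ X, m ≤ J w := fun w hw => csInf_le hbdd ⟨w, hw, rfl⟩
  have hseq : ∀ n : ℕ, ∃ w ∈ X, J w < m + 1 / ((n : ℝ) + 1) := by
    intro n
    obtain ⟨_, ⟨w, hw, rfl⟩, h⟩ := exists_lt_of_csInf_lt (s := J '' X)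
      ⟨_, 0, X.zero_mem, rfl⟩ (lt_add_of_pos_right m (by positivity : 0 < 1 / ((n : ℝ) + 1)))
    exact ⟨w, hw, h⟩
  choose w hwX hwJ using hseq
  obtain ⟨M, hM0, hM⟩ := exists_forall_rpow_sub_le hq (‖ℓ‖ * K) (m + 1) hL
  have hwM : ∀ n, ‖(w n).2‖ ^ q ≤ M ^ q := by
    intro n
    refine Real.rpow_le_rpow (norm_nonneg _) (hM _ (norm_nonneg _) ?_) hq0.le
    refine (hJ _ (hwX n)).trans ((hwJ n).le.trans ?_)
    gcongr
    rw [div_le_one (by positivity)]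
    linarith [(Nat.cast_nonneg n : (0 : ℝ) ≤ n)]
  have hcauchy : CauchySeq w := by
    rw [Metric.cauchySeq_iff']
    intro ε hε
    set η := (ε / K) ^ q with hη
    have hη0 : 0 < η := by positivity
    have hMq : 0 ≤ M ^ q := by positivity
    -- The target η is split in halves: this ε makes the first term at most η/2 because the energies
    -- are bounded by M^q, and `N` is then chosen to make the defect term less than η/2. The
    -- summands + 1 keep the denominators positive.
    obtain ⟨C, hC0, hC⟩ := exists_Lp_norm_sub_rpow_le (V := V) (μ := μ) hp hp_top
      (ε := η / (2 * (2 * M ^ q + 1))) (by positivity)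
    obtain ⟨N, hN⟩ := exists_nat_one_div_lt (K := ℝ) (ε := η / (2 * (C * q + 1))) (by positivity)
    refine ⟨N, fun n hn => ?_⟩
    -- The midpoint lies in X, so J there is at least m, while both ends are within 1/(N+1) of m.
    -- The linear part of J cancels and only the defect, divided by q, remains.
    have hd : (‖(w n).2‖ ^ q + ‖(w N).2‖ ^ q) / 2 - ‖(1 / 2 : ℝ) • ((w n).2 + (w N).2)‖ ^ q ≤
        q * (1 / ((N : ℝ) + 1)) := by
      have h1 := hm _ (X.smul_mem (1 / 2 : ℝ) (X.add_mem (hwX n) (hwX N)))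
      have h2 := hwJ n
      have h3 := hwJ N
      have h4 : 1 / ((n : ℝ) + 1) ≤ 1 / ((N : ℝ) + 1) := by gcongr
      simp only [J, map_smul, map_add, smul_eq_mul, Prod.smul_snd, Prod.snd_add] at h1 h2 h3
      have h5 : ((‖(w n).2‖ ^ q + ‖(w N).2‖ ^ q) / 2
          - ‖(1 / 2 : ℝ) • ((w n).2 + (w N).2)‖ ^ q) / q ≤ 1 / ((N : ℝ) + 1) := by
        rw [sub_div, div_right_comm, add_div]
        linarith
      rwa [div_le_iff₀' hq0] at h5
    have hfin : ‖(w n).2 - (w N).2‖ ^ q < η := by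
      have h1 := hC (w n).2 (w N).2
      have h2 : η / (2 * (2 * M ^ q + 1)) * (‖(w n).2‖ ^ q + ‖(w N).2‖ ^ q) ≤ η / 2 := by
        calc _ ≤ η / (2 * (2 * M ^ q + 1)) * (2 * M ^ q + 1) := by
              exact mul_le_mul_of_nonneg_left (by linarith [hwM n, hwM N]) (by positivity)
          _ = η / 2 := by field_simp
      have h3 : C * (q * (1 / ((N : ℝ) + 1))) < η / 2 := by
        calc C * (q * (1 / ((N : ℝ) + 1))) ≤ (C * q + 1) * (1 / ((N : ℝ) + 1)) := by
              rw [← mul_assoc]; gcongr; linarith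
          _ < (C * q + 1) * (η / (2 * (C * q + 1))) := by gcongr
          _ = η / 2 := by field_simp
      have h4 := mul_le_mul_of_nonneg_left hd hC0
      linarith
    have hlt : ‖(w n).2 - (w N).2‖ < ε / K :=
      (Real.rpow_lt_rpow_iff (norm_nonneg _) (by positivity) hq0).1 hfin
    rw [dist_eq_norm]
    calc _ ≤ K * ‖(w n - w N).2‖ := hK _ (X.sub_mem (hwX n) (hwX N))
      _ < K * (ε / K) := by gcongr; exact hlt
      _ = ε := by field_simp
  obtain ⟨w₀, hw₀⟩ := cauchySeq_tendsto_of_complete hcauchy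
  have hw₀X : w₀ ∈ X := hX.mem_of_tendsto hw₀ (.of_forall hwX)
  have hJc : Continuous J :=
    ((continuous_snd.norm.rpow_const fun _ => Or.inr hq0.le).div_const _).sub ℓ.continuous
  have hJw₀ : J w₀ ≤ m := by
    refine le_of_tendsto_of_tendsto' ((hJc.tendsto _).comp hw₀) ?_ fun n => (hwJ n).le
    simpa using (tendsto_one_div_add_atTop_nhds_zero_nat (𝕜 := ℝ)).const_add m
  exact ⟨w₀, .of_isMinOn hp hp_top hw₀X fun v hv => hJw₀.trans (hm v hv)⟩

lemma SolvesFlux.norm_rpow_le (hp : 1 < p) (hp_top : p ≠ ⊤) (hK : ∀ w ∈ X, ‖w‖ ≤ K * ‖w.2‖)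
    {ℓ : (Lp ℝ p μ × Lp V p μ) →L[ℝ] ℝ} {w : Lp ℝ p μ × Lp V p μ} (hw : SolvesFlux X ℓ w) :
    ‖w.2‖ ^ p.toReal ≤ ‖ℓ‖ * K * ‖w.2‖ := by
  rw [← fluxForm_self hp hp_top, hw.2 w hw.1]
  exact apply_le_of_norm_le hK ℓ hw.1

/-- Continuous dependence of weak solutions on the right-hand side. -/
theorem SolvesFlux.stability [FiniteDimensional ℝ V] (hp : 1 < p) (hp_top : p ≠ ⊤) (hK0 : 0 < K)
    (hK : ∀ w ∈ X, ‖w‖ ≤ K * ‖w.2‖) (ℓ : (Lp ℝ p μ × Lp V p μ) →L[ℝ] ℝ) {ε : ℝ} (hε : 0 < ε) :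
    ∃ δ > 0, ∀ ℓ' : (Lp ℝ p μ × Lp V p μ) →L[ℝ] ℝ, ‖ℓ' - ℓ‖ < δ →
      ∀ w w', SolvesFlux X ℓ w → SolvesFlux X ℓ' w' → ‖w' - w‖ < ε := by
  have hq := one_lt_toReal_of_ne_top hp hp_top
  set q := p.toReal with hqdef
  have hq0 : 0 < q := by linarith
  -- Perturbations satisfy ‖ℓ'‖ ≤ ‖ℓ‖ + 1, so a single a priori bound `M` serves both solutions.
  obtain ⟨M, hM0, hM⟩ := exists_forall_rpow_sub_le hq ((‖ℓ‖ + 1) * K) 0 (by positivity)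
  set η := (ε / K) ^ q with hη
  have hη0 : 0 < η := by positivity
  have hMq : 0 ≤ M ^ q := by positivity
  obtain ⟨C, hC0, hC⟩ := exists_Lp_norm_sub_rpow_le (V := V) (μ := μ) hp hp_top
    (ε := η / (2 * (2 * M ^ q + 1))) (by positivity)
  -- The factor q/4 comes from the midpoint bound, `K` from Poincaré's inequality, and 2M bounds the
  -- distance between the two gradients.
  set B := C * (q / 4) * K * (2 * M) with hB
  have hB0 : 0 ≤ B := by positivity
  refine ⟨min 1 (η / (2 * (B + 1))), by positivity, fun ℓ' hℓ w w' hw hw' => ?_⟩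
  obtain ⟨hℓ1, hℓ2⟩ := lt_min_iff.1 hℓ
  have bound : ∀ (l : (Lp ℝ p μ × Lp V p μ) →L[ℝ] ℝ) (u : Lp ℝ p μ × Lp V p μ),
      ‖l‖ ≤ ‖ℓ‖ + 1 → SolvesFlux X l u → ‖u.2‖ ≤ M := by
    intro l u hl hu
    refine hM _ (norm_nonneg _) ?_
    have h1 := hu.norm_rpow_le hp hp_top hK
    have h2 : ‖l‖ * K * ‖u.2‖ ≤ (‖ℓ‖ + 1) * K * ‖u.2‖ := by gcongr
    have h3 : ‖u.2‖ ^ q / q ≤ ‖u.2‖ ^ q := div_le_self (by positivity) hq.le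
    linarith
  have hwM := bound ℓ w (by linarith) hw
  have hwM' := bound ℓ' w' (by linarith [norm_le_norm_add_norm_sub' ℓ' ℓ]) hw'
  have hmem := X.sub_mem hw'.1 hw.1
  -- Subtract the two equations, both tested with w' - w.
  have hd : fluxForm w'.2 (w'.2 - w.2) - fluxForm w.2 (w'.2 - w.2) ≤
      ‖ℓ' - ℓ‖ * K * (2 * M) := by
    have h1 := apply_le_of_norm_le hK (ℓ' - ℓ) hmem
    rw [← Prod.snd_sub, hw'.2 _ hmem, hw.2 _ hmem]
    refine h1.trans ?_
    gcongr
    refine (norm_sub_le _ _).trans ?_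
    linarith
  have hfin : ‖w'.2 - w.2‖ ^ q < η := by
    have h1 := hC w'.2 w.2
    have h2 : η / (2 * (2 * M ^ q + 1)) * (‖w'.2‖ ^ q + ‖w.2‖ ^ q) ≤ η / 2 := by
      have e1 := Real.rpow_le_rpow (norm_nonneg _) hwM hq0.le
      have e2 := Real.rpow_le_rpow (norm_nonneg _) hwM' hq0.le
      calc _ ≤ η / (2 * (2 * M ^ q + 1)) * (2 * M ^ q + 1) :=
            mul_le_mul_of_nonneg_left (by linarith) (by positivity)
        _ = η / 2 := by field_simp
    have h3 := (fluxForm_midpoint_bound hp hp_top w'.2 w.2).trans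
      (mul_le_mul_of_nonneg_left hd (by positivity))
    have h4 : C * (q / 4 * (‖ℓ' - ℓ‖ * K * (2 * M))) < η / 2 := by
      calc C * (q / 4 * (‖ℓ' - ℓ‖ * K * (2 * M))) = B * ‖ℓ' - ℓ‖ := by rw [hB]; ring
        _ ≤ (B + 1) * ‖ℓ' - ℓ‖ := by gcongr; linarith
        _ < (B + 1) * (η / (2 * (B + 1))) := by gcongr
        _ = η / 2 := by field_simp
    have h5 := mul_le_mul_of_nonneg_left h3 hC0
    linarith
  have hlt : ‖w'.2 - w.2‖ < ε / K :=
    (Real.rpow_lt_rpow_iff (norm_nonneg _) (by positivity) hq0).1 hfin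
  calc _ ≤ K * ‖(w' - w).2‖ := hK _ hmem
    _ < K * (ε / K) := by gcongr; exact hlt
    _ = ε := by field_simp

theorem SolvesFlux.unique [FiniteDimensional ℝ V] (hp : 1 < p) (hp_top : p ≠ ⊤) (hK0 : 0 < K)
    (hK : ∀ w ∈ X, ‖w‖ ≤ K * ‖w.2‖) {ℓ : (Lp ℝ p μ × Lp V p μ) →L[ℝ] ℝ}
    {w w' : Lp ℝ p μ × Lp V p μ} (hw : SolvesFlux X ℓ w) (hw' : SolvesFlux X ℓ w') : w' = w := by
  rw [← sub_eq_zero, ← norm_eq_zero]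
  refine le_antisymm (le_of_forall_pos_le_add fun ε hε => ?_) (norm_nonneg _)
  obtain ⟨δ, hδ, h⟩ := stability hp hp_top hK0 hK ℓ hε
  simpa using (h ℓ (by rwa [sub_self, ContinuousLinearMap.opNorm_zero]) w w' hw hw').le

end Minimization

/-! ### Calculus of test functions -/

section TestFunctions

open Filter Topology

variable {N : ℕ} {Ω : Set (EuclideanSpace ℝ (Fin N))} {φ ψ : EuclideanSpace ℝ (Fin N) → ℝ}

lemma continuous_gradient (hφ : ContDiff ℝ ∞ φ) : Continuous (gradient φ) := by
  unfold gradient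
  exact (InnerProductSpace.toDual ℝ _).symm.continuous.comp (hφ.continuous_fderiv (by simp))

lemma inner_gradient (φ : EuclideanSpace ℝ (Fin N) → ℝ) (x v : EuclideanSpace ℝ (Fin N)) :
    inner ℝ (gradient φ x) v = fderiv ℝ φ x v := by
  rw [gradient, InnerProductSpace.toDual_symm_apply]

lemma norm_gradient (φ : EuclideanSpace ℝ (Fin N) → ℝ) (x : EuclideanSpace ℝ (Fin N)) :
    ‖gradient φ x‖ = ‖fderiv ℝ φ x‖ := by
  rw [gradient, LinearIsometryEquiv.norm_map]

lemma hasCompactSupport_gradient (hφ : HasCompactSupport φ) : HasCompactSupport (gradient φ) := by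
  unfold gradient
  exact (hφ.fderiv ℝ).comp_left (map_zero _)

namespace IsTestFunction

lemma eq_zero (hφ : IsTestFunction Ω φ) {x : EuclideanSpace ℝ (Fin N)} (hx : x ∉ Ω) : φ x = 0 :=
  image_eq_zero_of_notMem_tsupport fun h => hx (hφ.2.2 h)

lemma memLp (hφ : IsTestFunction Ω φ) (s : ℝ≥0∞) : MemLp φ s (volume.restrict Ω) :=
  (hφ.1.continuous.memLp_of_hasCompactSupport hφ.2.1).restrict Ω

lemma memLp_gradient (hφ : IsTestFunction Ω φ) (s : ℝ≥0∞) :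
    MemLp (gradient φ) s (volume.restrict Ω) :=
  ((continuous_gradient hφ.1).memLp_of_hasCompactSupport
    (hasCompactSupport_gradient hφ.2.1)).restrict Ω

lemma zero : IsTestFunction Ω (fun _ => 0) :=
  ⟨contDiff_const, HasCompactSupport.zero, by simp [tsupport]⟩

lemma add (hφ : IsTestFunction Ω φ) (hψ : IsTestFunction Ω ψ) : IsTestFunction Ω (φ + ψ) :=
  ⟨hφ.1.add hψ.1, hφ.2.1.add hψ.2.1,
    (tsupport_add φ ψ).trans (Set.union_subset hφ.2.2 hψ.2.2)⟩

lemma comp {θ : ℝ → ℝ} (hφ : IsTestFunction Ω φ) (hθ : ContDiff ℝ ∞ θ) (h0 : θ 0 = 0) :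
    IsTestFunction Ω (θ ∘ φ) :=
  ⟨hθ.comp hφ.1, hφ.2.1.comp_left h0,
    (closure_mono (Function.support_comp_subset h0 φ)).trans hφ.2.2⟩

lemma gradient_add (hφ : IsTestFunction Ω φ) (hψ : IsTestFunction Ω ψ)
    (x : EuclideanSpace ℝ (Fin N)) : gradient (φ + ψ) x = gradient φ x + gradient ψ x := by
  have h1 := (hφ.1.differentiable (by simp)).differentiableAt (x := x)
  have h2 := (hψ.1.differentiable (by simp)).differentiableAt (x := x)
  simp only [gradient]
  rw [fderiv_add h1 h2, map_add]

lemma gradient_comp {θ : ℝ → ℝ} (hφ : IsTestFunction Ω φ) (hθ : ContDiff ℝ ∞ θ)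
    (x : EuclideanSpace ℝ (Fin N)) : gradient (θ ∘ φ) x = deriv θ (φ x) • gradient φ x := by
  have h1 := ((hφ.1.differentiable (by simp)).differentiableAt (x := x)).hasFDerivAt
  have h2 := ((hθ.differentiable (by simp)).differentiableAt (x := φ x)).hasDerivAt
  simp only [gradient]
  rw [(h2.comp_hasFDerivAt x h1).fderiv, map_smul]

/-- Integration by parts for test functions. -/
lemma integral_smul_gradient (hφ : IsTestFunction Ω φ) (hψ : IsTestFunction Ω ψ) :
    ∫ x in Ω, φ x • gradient ψ x = -∫ x in Ω, ψ x • gradient φ x := by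
  -- Both integrands vanish outside Ω, so integration by parts takes place on the whole space and
  -- produces no boundary term.
  rw [setIntegral_eq_integral_of_forall_compl_eq_zero
    fun x hx => by rw [hφ.eq_zero hx, zero_smul],
    setIntegral_eq_integral_of_forall_compl_eq_zero
    fun x hx => by rw [hψ.eq_zero hx, zero_smul]]
  have i1 : Integrable (fun x => φ x • gradient ψ x) :=
    (hφ.1.continuous.smul (continuous_gradient hψ.1)).integrable_of_hasCompactSupport
      hφ.2.1.smul_right
  have i2 : Integrable (fun x => ψ x • gradient φ x) :=
    (hψ.1.continuous.smul (continuous_gradient hφ.1)).integrable_of_hasCompactSupport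
      hψ.2.1.smul_right
  have i3 : Integrable (fun x => φ x * ψ x) :=
    (hφ.1.continuous.mul hψ.1.continuous).integrable_of_hasCompactSupport hφ.2.1.mul_right
  refine ext_inner_left ℝ fun v => ?_
  rw [inner_neg_right, ← integral_inner i1, ← integral_inner i2]
  have i1' := i1.const_inner (𝕜 := ℝ) v
  have i2' := i2.const_inner (𝕜 := ℝ) v
  have hin : ∀ (χ : EuclideanSpace ℝ (Fin N) → ℝ) x, inner ℝ v (gradient χ x) = fderiv ℝ χ x v :=
    fun χ x => by rw [real_inner_comm, inner_gradient]
  simp only [real_inner_smul_right, hin] at i1' i2' ⊢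
  simp_rw [mul_comm (ψ _)] at i2' ⊢
  exact integral_mul_fderiv_eq_neg_fderiv_mul_of_integrable i2' i1' i3
    (fun x _ => hφ.1.differentiable (by simp) x) (fun x _ => hψ.1.differentiable (by simp) x)

end IsTestFunction

end TestFunctions

/-! ### Poincaré's inequality for test functions -/

section Poincare

variable {N : ℕ} {Ω : Set (EuclideanSpace ℝ (Fin N))} {φ : EuclideanSpace ℝ (Fin N) → ℝ}

/-- Poincaré's inequality for test functions, in integral form. -/
lemma IsTestFunction.integral_norm_rpow_le (hN : 0 < N) {R : ℝ} (hR0 : 0 ≤ R)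
    (hR : Ω ⊆ Metric.closedBall 0 R) (hφ : IsTestFunction Ω φ) {t : ℝ} (ht : 1 < t) :
    ∫ x in Ω, ‖φ x‖ ^ t ≤ t * R * ∫ x in Ω, ‖φ x‖ ^ (t - 1) * ‖gradient φ x‖ := by
  -- Write |φ|^t = |φ|^t ∂ᵢxᵢ and integrate by parts; |xᵢ| ≤ R on Ω. A positive dimension is needed
  -- to have a coordinate.
  let i : Fin N := ⟨0, hN⟩
  let e : EuclideanSpace ℝ (Fin N) := EuclideanSpace.single i 1
  let P : EuclideanSpace ℝ (Fin N) →L[ℝ] ℝ := EuclideanSpace.proj i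
  have hPe : P e = 1 := by simp [P, e]
  have hPle : ∀ x, ‖P x‖ ≤ ‖x‖ := fun x => PiLp.norm_apply_le x i
  have hd := hφ.1.differentiable (by simp)
  have hF : ContDiff ℝ 1 (fun x => ‖φ x‖ ^ t) := (hφ.1.of_le (by simp)).norm_rpow ht
  have hFs : HasCompactSupport (fun x => ‖φ x‖ ^ t) :=
    hφ.2.1.comp_left (g := fun y : ℝ => ‖y‖ ^ t) (by simp [Real.zero_rpow (by linarith : t ≠ 0)])
  have hF's : HasCompactSupport (fun x => fderiv ℝ (fun x => ‖φ x‖ ^ t) x e) :=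
    (hFs.fderiv ℝ).comp_left (g := fun L : EuclideanSpace ℝ (Fin N) →L[ℝ] ℝ => L e) rfl
  have hF'c : Continuous (fun x => fderiv ℝ (fun x => ‖φ x‖ ^ t) x e) :=
    (hF.continuous_fderiv (by simp)).clm_apply continuous_const
  have hPd : ∀ x, fderiv ℝ (fun x => P x) x e = 1 := fun x => by rw [P.fderiv, hPe]
  have i1 : Integrable (fun x => fderiv ℝ (fun x => ‖φ x‖ ^ t) x e * P x) :=
    (hF'c.mul P.continuous).integrable_of_hasCompactSupport hF's.mul_right
  have hibp := integral_mul_fderiv_eq_neg_fderiv_mul_of_integrable (μ := volume)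
    (f := fun x => ‖φ x‖ ^ t) (g := fun x => P x) (v := e) i1
    (by simp_rw [hPd, mul_one]; exact hF.continuous.integrable_of_hasCompactSupport hFs)
    ((hF.continuous.mul P.continuous).integrable_of_hasCompactSupport hFs.mul_right)
    (fun x _ => hF.differentiable (by simp) x) (fun x _ => P.differentiableAt)
  simp_rw [hPd, mul_one] at hibp
  have hG : Continuous fun x => ‖φ x‖ ^ (t - 1) * ‖gradient φ x‖ :=
    (hφ.1.continuous.norm.rpow_const fun _ => Or.inr (by linarith)).mul
      (continuous_gradient hφ.1).norm
  have hGs : HasCompactSupport fun x => ‖φ x‖ ^ (t - 1) * ‖gradient φ x‖ :=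
    (hasCompactSupport_gradient hφ.2.1).norm.mul_left
  have ht1 : t - 1 ≠ 0 := by linarith
  rw [setIntegral_eq_integral_of_forall_compl_eq_zero
    fun x hx => by rw [hφ.eq_zero hx, norm_zero, Real.zero_rpow (by linarith)],
    setIntegral_eq_integral_of_forall_compl_eq_zero
    fun x hx => by rw [hφ.eq_zero hx, norm_zero, Real.zero_rpow ht1, zero_mul],
    hibp, ← integral_neg, ← integral_const_mul]
  refine integral_mono i1.neg ((hG.integrable_of_hasCompactSupport hGs).const_mul _) fun x => ?_
  have hb : ‖fderiv ℝ (fun x => ‖φ x‖ ^ t) x e‖ ≤ t * ‖φ x‖ ^ (t - 1) * ‖gradient φ x‖ := by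
    refine (ContinuousLinearMap.le_opNorm _ _).trans ?_
    rw [show ‖e‖ = 1 by simp [e], mul_one, norm_gradient]
    exact norm_fderiv_norm_rpow_le hd ht
  refine (Real.le_norm_self _).trans ?_
  rw [norm_neg, norm_mul]
  by_cases hx : x ∈ Ω
  · have hxR : ‖P x‖ ≤ R := (hPle x).trans (by simpa using hR hx)
    calc _ ≤ t * ‖φ x‖ ^ (t - 1) * ‖gradient φ x‖ * R := by gcongr
      _ = _ := by ring
  · rw [hφ.eq_zero hx, norm_zero, Real.zero_rpow ht1, mul_zero, zero_mul] at hb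
    rw [le_antisymm hb (norm_nonneg _), zero_mul]
    positivity

/-- Poincaré's inequality for test functions. -/
lemma IsTestFunction.lpNorm_le (hN : 0 < N) {R : ℝ} (hR0 : 0 ≤ R)
    (hR : Ω ⊆ Metric.closedBall 0 R) (hφ : IsTestFunction Ω φ) {s : ℝ≥0∞} (hs : 1 < s)
    (hs_top : s ≠ ⊤) :
    lpNorm φ s (volume.restrict Ω) ≤
      s.toReal * R * lpNorm (gradient φ) s (volume.restrict Ω) := by
  have ht := one_lt_toReal_of_ne_top hs hs_top
  set t := s.toReal with htdef
  have ht0 : 0 < t := by linarith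
  have hsof : ENNReal.ofReal t = s := ENNReal.ofReal_toReal hs_top
  have hc : (t / (t - 1)).HolderConjugate t := (Real.HolderConjugate.conjExponent ht).symm
  have h1 := hφ.integral_norm_rpow_le hN hR0 hR ht
  have hmem : MemLp (fun x => ‖φ x‖ ^ (t - 1)) (ENNReal.ofReal (t / (t - 1)))
      (volume.restrict Ω) := by
    refine MemLp.restrict Ω (Continuous.memLp_of_hasCompactSupport
      (hφ.1.continuous.norm.rpow_const fun _ => Or.inr (by linarith)) ?_)
    exact hφ.2.1.comp_left (g := fun y : ℝ => ‖y‖ ^ (t - 1))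
      (by simp [Real.zero_rpow (by linarith : t - 1 ≠ 0)])
  have h2 := integral_mul_le_Lp_mul_Lq_of_nonneg hc
    (μ := volume.restrict Ω) (f := fun x => ‖φ x‖ ^ (t - 1)) (g := fun x => ‖gradient φ x‖)
    (.of_forall fun x => by positivity) (.of_forall fun x => norm_nonneg _) hmem
    (by rw [hsof]; exact (hφ.memLp_gradient s).norm)
  simp_rw [← Real.rpow_mul (norm_nonneg _), mul_div_cancel₀ t (by linarith : t - 1 ≠ 0),
    one_div] at h2
  have e1 := lpNorm_eq_integral_norm_rpow_toReal (μ := volume.restrict Ω) (f := φ) (p := s)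
    (by positivity) hs_top (hφ.memLp s).1
  have e2 := lpNorm_eq_integral_norm_rpow_toReal (μ := volume.restrict Ω) (f := gradient φ) (p := s)
    (by positivity) hs_top (hφ.memLp_gradient s).1
  rw [← htdef] at e1 e2
  rw [← e2] at h2
  set A := lpNorm φ s (volume.restrict Ω) with hA
  set B := lpNorm (gradient φ) s (volume.restrict Ω)
  have hA0 : 0 ≤ A := lpNorm_nonneg
  have hB0 : 0 ≤ B := lpNorm_nonneg
  have hI0 : 0 ≤ ∫ x in Ω, ‖φ x‖ ^ t := integral_nonneg fun x => by positivity
  have hAt : ∫ x in Ω, ‖φ x‖ ^ t = A ^ t := by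
    rw [e1, Real.rpow_inv_rpow hI0 ht0.ne']
  rw [hAt] at h1 h2
  rw [← Real.rpow_mul hA0, show t * (t / (t - 1))⁻¹ = t - 1 by field_simp] at h2
  -- Hölder's inequality has produced A^t ≤ tR A^(t-1) B; unless A = 0, cancel A^(t-1).
  rcases hA0.eq_or_lt with h0 | h0
  · rw [← h0]; positivity
  have h3 : A ^ (t - 1) * A ≤ A ^ (t - 1) * (t * R * B) := by
    calc A ^ (t - 1) * A = A ^ t := by
          nth_rewrite 2 [← Real.rpow_one A]; rw [← Real.rpow_add h0]; ring_nf
      _ ≤ t * R * (A ^ (t - 1) * B) := h1.trans (mul_le_mul_of_nonneg_left h2 (by positivity))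
      _ = _ := by ring
  exact le_of_mul_le_mul_left h3 (by positivity)

end Poincare

/-! ### Approximation by test functions, and the description of W^{1,p_-}_0(Ω) -/

section TestApprox

open Filter Topology

variable {N : ℕ} {Ω : Set (EuclideanSpace ℝ (Fin N))} {s : ℝ≥0∞}
  {f f' : EuclideanSpace ℝ (Fin N) → ℝ}
  {g g' : EuclideanSpace ℝ (Fin N) → EuclideanSpace ℝ (Fin N)}

/-- The pair `(f, g)` is a limit in `L^s(Ω)` of pairs `(φ, ∇φ)` with `φ ∈ C_c^∞(Ω)`. -/
def TestApprox (Ω : Set (EuclideanSpace ℝ (Fin N))) (s : ℝ≥0∞)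
    (f : EuclideanSpace ℝ (Fin N) → ℝ)
    (g : EuclideanSpace ℝ (Fin N) → EuclideanSpace ℝ (Fin N)) : Prop :=
  ∀ ε : ℝ≥0∞, ε ≠ 0 → ∃ φ, IsTestFunction Ω φ ∧
    eLpNorm (f - φ) s (volume.restrict Ω) ≤ ε ∧
    eLpNorm (g - gradient φ) s (volume.restrict Ω) ≤ ε

/-- Unfolds the closure in terms of functions instead of L^s classes, so that one pair of
representatives can be tested at every exponent s. -/
lemma mem_W1pZero_iff [Fact (1 ≤ s)] {y : LpPair Ω s} :
    y ∈ W1pZero Ω s ↔ TestApprox Ω s y.1 y.2 := by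
  rw [W1pZero, EMetric.mem_closure_iff]
  constructor
  · intro h ε hε
    obtain ⟨u, ⟨φ, hφ, h1, h2⟩, hu⟩ := h ε (pos_iff_ne_zero.2 hε)
    rw [Prod.edist_eq, max_lt_iff, Lp.edist_def, Lp.edist_def] at hu
    refine ⟨φ, hφ, (le_of_eq (eLpNorm_congr_ae ?_)).trans hu.1.le,
      (le_of_eq (eLpNorm_congr_ae ?_)).trans hu.2.le⟩
    · filter_upwards [h1] with x hx
      simp [hx]
    · filter_upwards [h2] with x hx
      simp [hx]
  · intro h ε hε
    obtain ⟨δ, hδ, hδε⟩ := exists_between hε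
    obtain ⟨φ, hφ, h1, h2⟩ := h δ hδ.ne'
    refine ⟨⟨(hφ.memLp s).toLp, (hφ.memLp_gradient s).toLp⟩,
      ⟨φ, hφ, (hφ.memLp s).coeFn_toLp, (hφ.memLp_gradient s).coeFn_toLp⟩, ?_⟩
    rw [Prod.edist_eq, max_lt_iff, Lp.edist_def, Lp.edist_def]
    refine ⟨(le_of_eq (eLpNorm_congr_ae ?_)).trans_lt (h1.trans_lt hδε),
      (le_of_eq (eLpNorm_congr_ae ?_)).trans_lt (h2.trans_lt hδε)⟩
    · filter_upwards [(hφ.memLp s).coeFn_toLp] with x hx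
      simp [hx]
    · filter_upwards [(hφ.memLp_gradient s).coeFn_toLp] with x hx
      simp [hx]

namespace TestApprox

lemma congr (h : TestApprox Ω s f g) (hf : f =ᵐ[volume.restrict Ω] f')
    (hg : g =ᵐ[volume.restrict Ω] g') : TestApprox Ω s f' g' := by
  intro ε hε
  obtain ⟨φ, hφ, h1, h2⟩ := h ε hε
  exact ⟨φ, hφ, (eLpNorm_congr_ae (hf.symm.sub (.refl _ _))).trans_le h1,
    (eLpNorm_congr_ae (hg.symm.sub (.refl _ _))).trans_le h2⟩

lemma of_test {φ : EuclideanSpace ℝ (Fin N) → ℝ} (hφ : IsTestFunction Ω φ) :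
    TestApprox Ω s φ (gradient φ) :=
  fun ε _ => ⟨φ, hφ, by simp, by simp⟩

lemma exists_seq (h : TestApprox Ω s f g) : ∃ φ : ℕ → EuclideanSpace ℝ (Fin N) → ℝ,
    (∀ n, IsTestFunction Ω (φ n)) ∧
    Tendsto (fun n => eLpNorm (φ n - f) s (volume.restrict Ω)) atTop (𝓝 0) ∧
    Tendsto (fun n => eLpNorm (gradient (φ n) - g) s (volume.restrict Ω)) atTop (𝓝 0) := by
  choose φ hφ h1 h2 using fun n : ℕ => h ((n : ℝ≥0∞)⁻¹) (by simp)
  simp_rw [eLpNorm_sub_comm f, eLpNorm_sub_comm g] at h1 h2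
  exact ⟨φ, hφ,
    tendsto_of_tendsto_of_tendsto_of_le_of_le tendsto_const_nhds
      ENNReal.tendsto_inv_nat_nhds_zero (fun _ => zero_le) h1,
    tendsto_of_tendsto_of_tendsto_of_le_of_le tendsto_const_nhds
      ENNReal.tendsto_inv_nat_nhds_zero (fun _ => zero_le) h2⟩

lemma of_forall_close (hs : 1 ≤ s) (hf : AEStronglyMeasurable f (volume.restrict Ω))
    (hg : AEStronglyMeasurable g (volume.restrict Ω))
    (h : ∀ ε : ℝ≥0∞, ε ≠ 0 → ∃ f' g', AEStronglyMeasurable f' (volume.restrict Ω) ∧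
      AEStronglyMeasurable g' (volume.restrict Ω) ∧ TestApprox Ω s f' g' ∧
      eLpNorm (f' - f) s (volume.restrict Ω) ≤ ε ∧
      eLpNorm (g' - g) s (volume.restrict Ω) ≤ ε) : TestApprox Ω s f g := by
  intro ε hε
  have hε2 : ε / 2 ≠ 0 := (ENNReal.half_pos hε).ne'
  obtain ⟨f', g', hf', hg', ha, h1, h2⟩ := h (ε / 2) hε2
  obtain ⟨φ, hφ, h3, h4⟩ := ha (ε / 2) hε2
  rw [eLpNorm_sub_comm] at h1 h2
  refine ⟨φ, hφ, ?_, ?_⟩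
  · rw [← sub_add_sub_cancel f f' φ, ← ENNReal.add_halves ε]
    exact (eLpNorm_add_le (hf.sub hf') (hf'.sub (hφ.memLp s).1) hs).trans (add_le_add h1 h3)
  · rw [← sub_add_sub_cancel g g' (gradient φ), ← ENNReal.add_halves ε]
    exact (eLpNorm_add_le (hg.sub hg') (hg'.sub (hφ.memLp_gradient s).1) hs).trans
      (add_le_add h2 h4)

lemma of_tendsto (hs : 1 ≤ s) (hf : AEStronglyMeasurable f (volume.restrict Ω))
    (hg : AEStronglyMeasurable g (volume.restrict Ω))
    {F : ℕ → EuclideanSpace ℝ (Fin N) → ℝ}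
    {G : ℕ → EuclideanSpace ℝ (Fin N) → EuclideanSpace ℝ (Fin N)}
    (hF : ∀ n, AEStronglyMeasurable (F n) (volume.restrict Ω))
    (hG : ∀ n, AEStronglyMeasurable (G n) (volume.restrict Ω))
    (h : ∀ n, TestApprox Ω s (F n) (G n))
    (hFf : Tendsto (fun n => eLpNorm (F n - f) s (volume.restrict Ω)) atTop (𝓝 0))
    (hGg : Tendsto (fun n => eLpNorm (G n - g) s (volume.restrict Ω)) atTop (𝓝 0)) :
    TestApprox Ω s f g := by
  refine of_forall_close hs hf hg fun ε hε => ?_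
  obtain ⟨n, h1, h2⟩ := ((ENNReal.tendsto_nhds_zero.1 hFf ε (pos_iff_ne_zero.2 hε)).and
    (ENNReal.tendsto_nhds_zero.1 hGg ε (pos_iff_ne_zero.2 hε))).exists
  exact ⟨F n, G n, hF n, hG n, h n, h1, h2⟩

lemma add (hs : 1 ≤ s) (hf : AEStronglyMeasurable f (volume.restrict Ω))
    (hg : AEStronglyMeasurable g (volume.restrict Ω))
    (hf' : AEStronglyMeasurable f' (volume.restrict Ω))
    (hg' : AEStronglyMeasurable g' (volume.restrict Ω))
    (h : TestApprox Ω s f g) (h' : TestApprox Ω s f' g') :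
    TestApprox Ω s (f + f') (g + g') := by
  intro ε hε
  have hε2 : ε / 2 ≠ 0 := (ENNReal.half_pos hε).ne'
  obtain ⟨φ, hφ, h1, h2⟩ := h (ε / 2) hε2
  obtain ⟨ψ, hψ, h3, h4⟩ := h' (ε / 2) hε2
  refine ⟨φ + ψ, hφ.add hψ, ?_, ?_⟩
  · rw [add_sub_add_comm, ← ENNReal.add_halves ε]
    exact (eLpNorm_add_le (hf.sub (hφ.memLp s).1) (hf'.sub (hψ.memLp s).1) hs).trans
      (add_le_add h1 h3)
  · rw [show gradient (φ + ψ) = gradient φ + gradient ψ from funext (hφ.gradient_add hψ),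
      add_sub_add_comm, ← ENNReal.add_halves ε]
    exact (eLpNorm_add_le (hg.sub (hφ.memLp_gradient s).1) (hg'.sub (hψ.memLp_gradient s).1)
      hs).trans (add_le_add h2 h4)

lemma const_smul (c : ℝ) (h : TestApprox Ω s f g) : TestApprox Ω s (c • f) (c • g) := by
  rcases eq_or_ne c 0 with rfl | hc
  · rw [zero_smul, zero_smul]
    convert of_test (s := s) (Ω := Ω) IsTestFunction.zero using 1
    · rfl
    · funext x
      simp [gradient]
  intro ε hε
  have hc' : ‖c‖ₑ ≠ 0 := by simpa using hc
  obtain ⟨φ, hφ, h1, h2⟩ := h (ε / ‖c‖ₑ) (by simp [hε])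
  have hθ : ContDiff ℝ ∞ fun t : ℝ => c * t := contDiff_const.mul contDiff_id
  refine ⟨_, hφ.comp hθ (mul_zero c), ?_, ?_⟩
  · rw [show c • f - (fun t : ℝ => c * t) ∘ φ = c • (f - φ) by
      funext x; simp [mul_sub], eLpNorm_const_smul]
    exact (mul_le_mul_right h1 _).trans (ENNReal.mul_div_le)
  · rw [show c • g - gradient ((fun t : ℝ => c * t) ∘ φ) = c • (g - gradient φ) by
      funext x
      have hd : deriv (fun t : ℝ => c * t) (φ x) = c := by
        simp
      simp [hφ.gradient_comp hθ, hd, smul_sub], eLpNorm_const_smul]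
    exact (mul_le_mul_right h2 _).trans (ENNReal.mul_div_le)

end TestApprox

/-- On a finite measure space L^s embeds in L¹, so L^s convergence survives pairing with a bounded
factor. This passes to the limit in the definition of the weak gradient. -/
lemma lintegral_enorm_mul_bounded_le {α F G : Type*} [MeasurableSpace α] {μ : Measure α}
    [IsFiniteMeasure μ] [NormedAddCommGroup F] [NormedAddCommGroup G] {a : α → F} {b : α → G}
    (ha : AEStronglyMeasurable a μ) (hs : 1 ≤ s) {C : ℝ} (hb : ∀ x, ‖b x‖ ≤ C) :
    ∫⁻ x, ‖a x‖ₑ * ‖b x‖ₑ ∂μ ≤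
      eLpNorm a s μ * (μ Set.univ ^ (1 / (1 : ℝ≥0∞).toReal - 1 / s.toReal) * ENNReal.ofReal C) := by
  calc ∫⁻ x, ‖a x‖ₑ * ‖b x‖ₑ ∂μ ≤ ∫⁻ x, ‖a x‖ₑ * ENNReal.ofReal C ∂μ := by
        gcongr with x
        rw [← ofReal_norm]
        exact ENNReal.ofReal_le_ofReal (hb x)
    _ = eLpNorm a 1 μ * ENNReal.ofReal C := by
        rw [lintegral_mul_const'' _ ha.enorm, eLpNorm_one_eq_lintegral_enorm]
    _ ≤ _ := by
        rw [← mul_assoc]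
        gcongr
        exact eLpNorm_le_eLpNorm_mul_rpow_measure_univ hs ha

lemma tendsto_integral_of_lintegral_enorm_sub_le {α F : Type*} [MeasurableSpace α]
    {μ : Measure α} [NormedAddCommGroup F] [NormedSpace ℝ F]
    {a : ℕ → α → F} {a₀ : α → F} {C : ℝ≥0∞} {e : ℕ → ℝ≥0∞}
    (h : ∀ n, Integrable (a n) μ) (h₀ : Integrable a₀ μ) (hC : C ≠ ⊤)
    (he : Tendsto e atTop (𝓝 0)) (hle : ∀ n, ∫⁻ x, ‖a n x - a₀ x‖ₑ ∂μ ≤ e n * C) :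
    Tendsto (fun n => ∫ x, a n x ∂μ) atTop (𝓝 (∫ x, a₀ x ∂μ)) := by
  refine tendsto_integral_of_L1 _ h₀.1 (.of_forall h) ?_
  have h2 : Tendsto (fun n => e n * C) atTop (𝓝 0) := by
    simpa using ENNReal.Tendsto.mul_const he (Or.inr hC)
  exact tendsto_of_tendsto_of_tendsto_of_le_of_le tendsto_const_nhds h2 (fun _ => zero_le) hle

/-- Limits of test functions have weak gradients. -/
lemma TestApprox.isWeakGradient [IsFiniteMeasure (volume.restrict Ω)] (hs : 1 ≤ s)
    (hf : MemLp f s (volume.restrict Ω)) (hg : MemLp g s (volume.restrict Ω))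
    (h : TestApprox Ω s f g) : IsWeakGradient Ω f g := by
  intro ψ hψ
  obtain ⟨φ, hφ, h1, h2⟩ := h.exists_seq
  obtain ⟨C₁, hC₁⟩ := (continuous_gradient hψ.1).bounded_above_of_compact_support
    (hasCompactSupport_gradient hψ.2.1)
  obtain ⟨C₂, hC₂⟩ := hψ.1.continuous.bounded_above_of_compact_support hψ.2.1
  have hfin : ∀ C : ℝ, volume.restrict Ω Set.univ ^
      (1 / (1 : ℝ≥0∞).toReal - 1 / s.toReal) * ENNReal.ofReal C ≠ ⊤ := by
    intro C
    refine ENNReal.mul_ne_top (ENNReal.rpow_ne_top_of_nonneg ?_ (measure_ne_top _ _))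
      ENNReal.ofReal_ne_top
    rcases eq_or_ne s ⊤ with rfl | hst
    · simp
    · have : 1 ≤ s.toReal := by
        rwa [← ENNReal.toReal_one, ENNReal.toReal_le_toReal ENNReal.one_ne_top hst]
      simpa using inv_le_one_of_one_le₀ this
  have int1 : ∀ {a : EuclideanSpace ℝ (Fin N) → ℝ}, MemLp a s (volume.restrict Ω) →
      Integrable (fun x => a x • gradient ψ x) (volume.restrict Ω) := fun ha =>
    (ha.integrable hs).smul_bdd C₁ (hψ.memLp_gradient s).1 (.of_forall hC₁)
  have int2 : ∀ {b : EuclideanSpace ℝ (Fin N) → EuclideanSpace ℝ (Fin N)},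
      MemLp b s (volume.restrict Ω) →
      Integrable (fun x => ψ x • b x) (volume.restrict Ω) := fun hb =>
    (hb.integrable hs).bdd_smul C₂ (hψ.memLp s).1 (.of_forall hC₂)
  have t1 := tendsto_integral_of_lintegral_enorm_sub_le
    (fun n => int1 ((hφ n).memLp s)) (int1 hf) (hfin C₁) h1 fun n => by
      refine le_trans (le_of_eq (lintegral_congr fun x => ?_))
        (lintegral_enorm_mul_bounded_le (((hφ n).memLp s).sub hf).1 hs hC₁)
      rw [← sub_smul, enorm_smul, Pi.sub_apply]
  have t2 := tendsto_integral_of_lintegral_enorm_sub_le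
    (fun n => int2 ((hφ n).memLp_gradient s)) (int2 hg) (hfin C₂) h2 fun n => by
      refine le_trans (le_of_eq (lintegral_congr fun x => ?_))
        (lintegral_enorm_mul_bounded_le (((hφ n).memLp_gradient s).sub hg).1 hs hC₂)
      rw [← smul_sub, enorm_smul, Pi.sub_apply, mul_comm]
  refine tendsto_nhds_unique t1 (t2.neg.congr fun n => ?_)
  exact ((hφ n).integral_smul_gradient hψ).symm

/-- The difference of the gradients annihilates every test function, so the fundamental lemma of the
calculus of variations applies. Membership in `W1pMinus` only matches the functions, not the
gradients; this supplies the missing match. -/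
lemma IsWeakGradient.ae_eq (hΩ : IsOpen Ω) (hff' : f =ᵐ[volume.restrict Ω] f')
    (hg : Integrable g (volume.restrict Ω)) (hg' : Integrable g' (volume.restrict Ω))
    (h : IsWeakGradient Ω f g) (h' : IsWeakGradient Ω f' g') : g =ᵐ[volume.restrict Ω] g' := by
  have hd : IntegrableOn (g - g') Ω volume := hg.sub hg'
  have key := hΩ.ae_eq_zero_of_integral_contDiff_smul_eq_zero hd.locallyIntegrableOn
    fun φ h1 h2 h3 => ?_
  · filter_upwards [(ae_restrict_iff' hΩ.measurableSet).2 key] with x hx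
    exact sub_eq_zero.1 hx
  · have hφ : IsTestFunction Ω φ := ⟨h1, h2, h3⟩
    obtain ⟨C, hC⟩ := h1.continuous.bounded_above_of_compact_support h2
    have e1 := h φ hφ
    have e2 := h' φ hφ
    rw [← setIntegral_eq_integral_of_forall_compl_eq_zero (s := Ω)
      fun x hx => by rw [hφ.eq_zero hx, zero_smul]]
    simp_rw [Pi.sub_apply, smul_sub]
    have i1 : Integrable (fun x => φ x • g x) (volume.restrict Ω) :=
      hg.bdd_smul C (hφ.memLp 1).1 (.of_forall hC)
    have i2 : Integrable (fun x => φ x • g' x) (volume.restrict Ω) :=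
      hg'.bdd_smul C (hφ.memLp 1).1 (.of_forall hC)
    rw [integral_sub i1 i2, sub_eq_zero, ← neg_inj, ← e1, ← e2]
    refine integral_congr_ae ?_
    filter_upwards [hff'] with x hx
    rw [hx]

/-- `W^{1,p_-}_0(Ω)` consists of the pairs in `L^p` that are, for every `s < p`, limits in
`W^{1,s}` of test functions. -/
lemma mem_W1pMinus_iff [IsFiniteMeasure (volume.restrict Ω)] (hΩ : IsOpen Ω) {p : ℝ≥0∞}
    [Fact (1 ≤ p)] (hp : 1 < p) {u : LpPair Ω p} :
    u ∈ W1pMinus Ω p ↔ ∀ s : ℝ≥0∞, 1 < s → s < p → TestApprox Ω s u.1 u.2 := by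
  constructor
  · rintro ⟨hu, h⟩ s hs hsp
    have : Fact (1 ≤ s) := ⟨hs.le⟩
    obtain ⟨y, hy, hyu⟩ := h s hs hsp
    have hy' := mem_W1pZero_iff.1 hy
    refine hy'.congr hyu ?_
    exact (hy'.isWeakGradient hs.le (Lp.memLp _) (Lp.memLp _)).ae_eq hΩ hyu
      ((Lp.memLp y.2).integrable hs.le) ((Lp.memLp u.2).integrable hp.le) hu
  · intro h
    constructor
    · obtain ⟨s, hs, hsp⟩ := exists_between hp
      exact (h s hs hsp).isWeakGradient hs.le ((Lp.memLp _).mono_exponent hsp.le)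
        ((Lp.memLp _).mono_exponent hsp.le)
    · intro s _ hs hsp
      have m1 : MemLp u.1 s (volume.restrict Ω) := (Lp.memLp _).mono_exponent hsp.le
      have m2 : MemLp u.2 s (volume.restrict Ω) := (Lp.memLp _).mono_exponent hsp.le
      exact ⟨⟨m1.toLp, m2.toLp⟩, mem_W1pZero_iff.2 ((h s hs hsp).congr m1.coeFn_toLp.symm
        m2.coeFn_toLp.symm), m1.coeFn_toLp⟩

end TestApprox

/-! ### Poincaré's inequality up to the exponent p -/

section PoincareMinus

open Filter Topology

/-- If `‖f‖_s ≤ A` for all `s` slightly below `p`, then `‖f‖_p ≤ A`. -/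
lemma lpNorm_le_of_forall_lt {α F : Type*} [MeasurableSpace α] {μ : Measure α}
    [IsFiniteMeasure μ] [NormedAddCommGroup F] {p : ℝ≥0∞} (hp : 1 < p) (hp_top : p ≠ ⊤)
    {f : α → F} (hf : MemLp f p μ) {A : ℝ} (hA : 0 ≤ A)
    (h : ∀ s : ℝ≥0∞, 1 < s → s < p → lpNorm f s μ ≤ A) : lpNorm f p μ ≤ A := by
  have hq := one_lt_toReal_of_ne_top hp hp_top
  set q := p.toReal with hqdef
  have hq0 : 0 < q := by linarith
  -- The shift by 2 keeps every exponent strictly above 1; a shift by 1 would start at exactly 1.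
  let t : ℕ → ℝ := fun n => q - (q - 1) / ((n : ℝ) + 2)
  have ht1 : ∀ n, 1 < t n := by
    intro n
    have hn : (0 : ℝ) ≤ n := Nat.cast_nonneg n
    have : (q - 1) / ((n : ℝ) + 2) < q - 1 := div_lt_self (by linarith) (by linarith)
    simp only [t]
    linarith
  have htq : ∀ n, t n < q := by
    intro n
    have : 0 < (q - 1) / ((n : ℝ) + 2) := div_pos (by linarith) (by positivity)
    simp only [t]
    linarith
  have htlim : Tendsto t atTop (𝓝 q) := by
    have h1 : Tendsto (fun n : ℕ => (q - 1) / ((n : ℝ) + 2)) atTop (𝓝 0) :=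
      tendsto_const_nhds.div_atTop
        (tendsto_atTop_add_const_right _ _ tendsto_natCast_atTop_atTop)
    simpa using h1.const_sub q
  have hrpow : ∀ x : ℝ, Tendsto (fun n => ENNReal.ofReal (x ^ t n)) atTop
      (𝓝 (ENNReal.ofReal (x ^ q))) := by
    intro x
    refine ENNReal.tendsto_ofReal ?_
    rcases eq_or_ne x 0 with rfl | hx
    · simp_rw [Real.zero_rpow hq0.ne', fun n => Real.zero_rpow (by linarith [ht1 n] : t n ≠ 0)]
      exact tendsto_const_nhds
    · exact (Real.continuousAt_const_rpow hx).tendsto.comp htlim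
  have hint : ∀ n, ∫⁻ x, ENNReal.ofReal (‖f x‖ ^ t n) ∂μ ≤ ENNReal.ofReal (A ^ t n) := by
    intro n
    have hs1 : 1 < ENNReal.ofReal (t n) := by simpa using ht1 n
    have hsp : ENNReal.ofReal (t n) < p := by
      rw [ENNReal.ofReal_lt_iff_lt_toReal (by linarith [ht1 n]) hp_top]; exact htq n
    have hm : MemLp f (ENNReal.ofReal (t n)) μ := hf.mono_exponent hsp.le
    have ht0 : 0 < t n := by linarith [ht1 n]
    have h1 := h _ hs1 hsp
    have hi := hm.integrable_norm_rpow (by positivity) ENNReal.ofReal_ne_top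
    rw [lpNorm_eq_integral_norm_rpow_toReal (by positivity) ENNReal.ofReal_ne_top hm.1] at h1
    rw [ENNReal.toReal_ofReal ht0.le] at h1 hi
    rw [← ofReal_integral_eq_lintegral_ofReal hi (.of_forall fun x => by positivity)]
    refine ENNReal.ofReal_le_ofReal ?_
    have hI : 0 ≤ ∫ x, ‖f x‖ ^ t n ∂μ := integral_nonneg fun x => by positivity
    calc _ = ((∫ x, ‖f x‖ ^ t n ∂μ) ^ (t n)⁻¹) ^ t n := (Real.rpow_inv_rpow hI ht0.ne').symm
      _ ≤ _ := Real.rpow_le_rpow (by positivity) h1 ht0.le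
  -- Only the pointwise limit of |f|^t as t increases to q is needed, so Fatou's lemma replaces
  -- continuity of t ↦ ‖f‖_t.
  have hfatou : ∫⁻ x, ENNReal.ofReal (‖f x‖ ^ q) ∂μ ≤ ENNReal.ofReal (A ^ q) := by
    calc ∫⁻ x, ENNReal.ofReal (‖f x‖ ^ q) ∂μ
        = ∫⁻ x, liminf (fun n => ENNReal.ofReal (‖f x‖ ^ t n)) atTop ∂μ :=
          lintegral_congr fun x => (hrpow ‖f x‖).liminf_eq.symm
      _ ≤ liminf (fun n => ∫⁻ x, ENNReal.ofReal (‖f x‖ ^ t n) ∂μ) atTop :=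
          lintegral_liminf_le' fun n => (hf.1.norm.aemeasurable.pow_const _).ennreal_ofReal
      _ ≤ liminf (fun n => ENNReal.ofReal (A ^ t n)) atTop :=
          liminf_le_liminf (.of_forall hint)
      _ = ENNReal.ofReal (A ^ q) := (hrpow A).liminf_eq
  have hi := hf.integrable_norm_rpow (by positivity) hp_top
  rw [lpNorm_eq_integral_norm_rpow_toReal (by positivity) hp_top hf.1, ← hqdef]
  rw [← hqdef] at hi
  rw [← ofReal_integral_eq_lintegral_ofReal hi (.of_forall fun x => by positivity),
    ENNReal.ofReal_le_ofReal_iff (by positivity)] at hfatou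
  calc _ ≤ (A ^ q) ^ q⁻¹ :=
        Real.rpow_le_rpow (integral_nonneg fun x => by positivity) hfatou (by positivity)
    _ = A := Real.rpow_rpow_inv hA hq0.ne'

variable {N : ℕ} {Ω : Set (EuclideanSpace ℝ (Fin N))}

lemma TestApprox.lpNorm_le (hN : 0 < N) {R : ℝ} (hR0 : 0 ≤ R)
    (hR : Ω ⊆ Metric.closedBall 0 R) {s : ℝ≥0∞} (hs : 1 < s) (hs_top : s ≠ ⊤)
    {f : EuclideanSpace ℝ (Fin N) → ℝ} {g : EuclideanSpace ℝ (Fin N) → EuclideanSpace ℝ (Fin N)}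
    (hf : MemLp f s (volume.restrict Ω)) (hg : MemLp g s (volume.restrict Ω))
    (h : TestApprox Ω s f g) :
    lpNorm f s (volume.restrict Ω) ≤ s.toReal * R * lpNorm g s (volume.restrict Ω) := by
  obtain ⟨φ, hφ, h1, h2⟩ := h.exists_seq
  have conv : ∀ {F : Type} [NormedAddCommGroup F] {a : ℕ → EuclideanSpace ℝ (Fin N) → F}
      {b : EuclideanSpace ℝ (Fin N) → F}, (∀ n, MemLp (a n) s (volume.restrict Ω)) →
      MemLp b s (volume.restrict Ω) →
      Tendsto (fun n => eLpNorm (a n - b) s (volume.restrict Ω)) atTop (𝓝 0) →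
      Tendsto (fun n => lpNorm (a n) s (volume.restrict Ω)) atTop
        (𝓝 (lpNorm b s (volume.restrict Ω))) := by
    intro F _ a b ha hb hab
    have : Fact (1 ≤ s) := ⟨hs.le⟩
    have := (Lp.tendsto_Lp_iff_tendsto_eLpNorm'' a ha b hb).2 hab
    refine (this.norm.congr fun n => ?_).trans_eq ?_
    · rw [Lp.norm_toLp, toReal_eLpNorm (ha n).1]
    · rw [Lp.norm_toLp, toReal_eLpNorm hb.1]
  exact le_of_tendsto_of_tendsto' (conv (fun n => (hφ n).memLp s) hf h1)
    ((conv (fun n => (hφ n).memLp_gradient s) hg h2).const_mul _)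
    fun n => (hφ n).lpNorm_le hN hR0 hR hs hs_top

/-- Poincaré's inequality in `W^{1,p_-}_0(Ω)`. -/
theorem exists_norm_le_of_testApprox (hN : 0 < N) (hΩb : Bornology.IsBounded Ω)
    {p : ℝ≥0∞} [Fact (1 ≤ p)] (hp : 1 < p) (hp_top : p ≠ ⊤) :
    ∃ K : ℝ, 0 < K ∧ ∀ u : LpPair Ω p,
      (∀ s : ℝ≥0∞, 1 < s → s < p → TestApprox Ω s u.1 u.2) → ‖u‖ ≤ K * ‖u.2‖ := by
  have : IsFiniteMeasure (volume.restrict Ω) :=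
    ⟨by simpa using hΩb.measure_lt_top⟩
  obtain ⟨R, hR0, hR⟩ := hΩb.subset_closedBall_lt 0 0
  have hq := one_lt_toReal_of_ne_top hp hp_top
  -- The exponent 1/s - 1/p lies in [0, 1], so |Ω|^(1/s - 1/p) ≤ m uniformly in s. This makes the
  -- constant `A` independent of s.
  set m : ℝ := max 1 (volume.restrict Ω Set.univ).toReal
  have hm1 : 1 ≤ m := le_max_left _ _
  set A : ℝ := p.toReal * R * m
  have hA : 0 < A := by positivity
  refine ⟨max 1 A, by positivity, fun u hu => ?_⟩
  have hlp : ∀ {F : Type} [NormedAddCommGroup F] (f : Lp F p (volume.restrict Ω)),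
      lpNorm f p (volume.restrict Ω) = ‖f‖ := fun f => by
    rw [Lp.norm_def, toReal_eLpNorm (Lp.aestronglyMeasurable f)]
  have h1 : ‖u.1‖ ≤ A * ‖u.2‖ := by
    rw [← hlp]
    refine lpNorm_le_of_forall_lt hp hp_top (Lp.memLp u.1) (by positivity) fun s hs hsp => ?_
    have hs_top : s ≠ ⊤ := hsp.ne_top
    have ht := one_lt_toReal_of_ne_top hs hs_top
    have htq : s.toReal ≤ p.toReal := ENNReal.toReal_mono hp_top hsp.le
    have m2 : MemLp u.2 s (volume.restrict Ω) := (Lp.memLp u.2).mono_exponent hsp.le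
    have h2 := (hu s hs hsp).lpNorm_le hN hR0.le hR hs hs_top
      ((Lp.memLp u.1).mono_exponent hsp.le) m2
    have h3 : lpNorm u.2 s (volume.restrict Ω) ≤ ‖u.2‖ * m := by
      rw [← toReal_eLpNorm m2.1, Lp.norm_def]
      have h4 := eLpNorm_le_eLpNorm_mul_rpow_measure_univ hsp.le (Lp.aestronglyMeasurable u.2)
      have he0 : 0 ≤ 1 / s.toReal - 1 / p.toReal :=
        sub_nonneg.2 (one_div_le_one_div_of_le (by linarith) htq)
      have he1 : 1 / s.toReal - 1 / p.toReal ≤ 1 := by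
        have a1 : 1 / s.toReal ≤ 1 := by rw [div_le_one (by linarith)]; exact ht.le
        have a2 : 0 < 1 / p.toReal := by positivity
        linarith
      have hfin := ENNReal.rpow_ne_top_of_nonneg he0 (measure_ne_top (volume.restrict Ω) Set.univ)
      refine (ENNReal.toReal_mono (ENNReal.mul_ne_top (Lp.eLpNorm_ne_top _) hfin) h4).trans ?_
      rw [ENNReal.toReal_mul, ← ENNReal.toReal_rpow]
      gcongr
      calc _ ≤ m ^ (1 / s.toReal - 1 / p.toReal) :=
            Real.rpow_le_rpow ENNReal.toReal_nonneg (le_max_right _ _) he0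
        _ ≤ m ^ (1 : ℝ) := Real.rpow_le_rpow_of_exponent_le hm1 he1
        _ = m := Real.rpow_one m
    calc _ ≤ s.toReal * R * lpNorm u.2 s (volume.restrict Ω) := h2
      _ ≤ p.toReal * R * (‖u.2‖ * m) := by gcongr; exact lpNorm_nonneg
      _ = A * ‖u.2‖ := by simp only [A]; ring
  rw [Prod.norm_def]
  refine max_le (h1.trans ?_) ?_
  · gcongr
    exact le_max_right _ _
  · exact le_mul_of_one_le_left (norm_nonneg _) (le_max_left _ _)

end PoincareMinus

/-! ### Chain rule and absolute values -/

section ChainRule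

open Filter Topology

lemma tendsto_eLpNorm_smul_zero {α F : Type*} [MeasurableSpace α] {μ : Measure α}
    [NormedAddCommGroup F] [NormedSpace ℝ F] {s : ℝ≥0∞} (hs : 1 ≤ s) (hs_top : s ≠ ⊤) {g : α → F}
    (hg : MemLp g s μ) {c : ℕ → α → ℝ} (hc : ∀ n, AEStronglyMeasurable (c n) μ)
    (hc2 : ∀ n x, ‖c n x‖ ≤ 2) (hlim : ∀ᵐ x ∂μ, Tendsto (fun n => c n x) atTop (𝓝 0)) :
    Tendsto (fun n => eLpNorm (fun x => c n x • g x) s μ) atTop (𝓝 0) := by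
  have hs0 : s ≠ 0 := (zero_lt_one.trans_le hs).ne'
  have ht : 0 < s.toReal := ENNReal.toReal_pos hs0 hs_top
  have hfin : ∫⁻ x, ‖(2 : ℝ) • g x‖ₑ ^ s.toReal ∂μ ≠ ⊤ :=
    (lintegral_rpow_enorm_lt_top_of_eLpNorm_lt_top hs0 hs_top (hg.const_smul (2 : ℝ)).2).ne
  have key : Tendsto (fun n => ∫⁻ x, ‖c n x • g x‖ₑ ^ s.toReal ∂μ) atTop (𝓝 (∫⁻ _, 0 ∂μ)) := by
    refine tendsto_lintegral_of_dominated_convergence' _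
      (fun n => (((hc n).smul hg.1).enorm.pow_const _)) (fun n => .of_forall fun x => ?_) hfin ?_
    · refine ENNReal.rpow_le_rpow ?_ ht.le
      rw [enorm_smul, enorm_smul]
      refine mul_le_mul_left ?_ _
      rw [← ofReal_norm, ← ofReal_norm]
      exact ENNReal.ofReal_le_ofReal ((hc2 n x).trans (by simp))
    · filter_upwards [hlim] with x hx
      have h1 : Tendsto (fun n => ‖c n x • g x‖ₑ) atTop (𝓝 0) := by
        simpa using (hx.smul_const (g x)).enorm
      have h2 := ((ENNReal.continuous_rpow_const (y := s.toReal)).tendsto 0).comp h1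
      rwa [ENNReal.zero_rpow_of_pos ht] at h2
  simp_rw [eLpNorm_eq_lintegral_rpow_enorm_toReal hs0 hs_top]
  rw [lintegral_zero] at key
  have hp : 0 < 1 / s.toReal := by positivity
  have h2 := ((ENNReal.continuous_rpow_const (y := 1 / s.toReal)).tendsto 0).comp key
  rwa [ENNReal.zero_rpow_of_pos hp] at h2

variable {N : ℕ} {Ω : Set (EuclideanSpace ℝ (Fin N))} {s : ℝ≥0∞}
  {f : EuclideanSpace ℝ (Fin N) → ℝ}
  {g : EuclideanSpace ℝ (Fin N) → EuclideanSpace ℝ (Fin N)}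

/-- Chain rule in the closure of the test functions. -/
lemma TestApprox.comp {θ : ℝ → ℝ} (hs : 1 ≤ s) (hs_top : s ≠ ⊤)
    (hf : MemLp f s (volume.restrict Ω)) (hg : MemLp g s (volume.restrict Ω))
    (hθ : ContDiff ℝ ∞ θ) (h0 : θ 0 = 0) (hθ1 : ∀ t, ‖deriv θ t‖ ≤ 1) (h : TestApprox Ω s f g) :
    TestApprox Ω s (θ ∘ f) (fun x => deriv θ (f x) • g x) := by
  obtain ⟨φ, hφ, h1, h2⟩ := h.exists_seq
  -- An almost everywhere convergent subsequence is needed because θ' is merely continuous, so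
  -- θ'(φₙ) → θ'(f) is available only pointwise.
  obtain ⟨ns, hns, hae⟩ := (tendstoInMeasure_of_tendsto_eLpNorm
    (zero_lt_one.trans_le hs).ne' (fun n => ((hφ n).memLp s).1) hf.1 h1).exists_seq_tendsto_ae
  have hdc : Continuous (deriv θ) := hθ.continuous_deriv (by simp)
  have hlip : LipschitzWith 1 θ :=
    lipschitzWith_of_nnnorm_deriv_le (hθ.differentiable (by simp)) hθ1
  refine of_tendsto hs (hθ.continuous.comp_aestronglyMeasurable hf.1)
    ((hdc.comp_aestronglyMeasurable hf.1).smul hg.1)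
    (F := fun n => θ ∘ φ (ns n)) (G := fun n => gradient (θ ∘ φ (ns n)))
    (fun n => (((hφ _).comp hθ h0).memLp s).1)
    (fun n => (((hφ _).comp hθ h0).memLp_gradient s).1) (fun n => of_test ((hφ _).comp hθ h0)) ?_ ?_
  · refine tendsto_of_tendsto_of_tendsto_of_le_of_le tendsto_const_nhds
      (h1.comp hns.tendsto_atTop) (fun _ => zero_le) fun n => eLpNorm_mono fun x => ?_
    simpa [dist_eq_norm] using hlip.dist_le_mul (φ (ns n) x) (f x)
  · have t1 := tendsto_eLpNorm_smul_zero hs hs_top hg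
      (c := fun n x => deriv θ (φ (ns n) x) - deriv θ (f x))
      (fun n => (hdc.comp_aestronglyMeasurable ((hφ (ns n)).memLp s).1).sub
        (hdc.comp_aestronglyMeasurable hf.1))
      (fun n x => (norm_sub_le _ _).trans (by linarith [hθ1 (φ (ns n) x), hθ1 (f x)]))
      (by
        filter_upwards [hae] with x hx
        simpa using ((hdc.tendsto _).comp hx).sub_const (deriv θ (f x)))
    have t2 := (h2.comp hns.tendsto_atTop).add t1
    rw [add_zero] at t2
    refine tendsto_of_tendsto_of_tendsto_of_le_of_le tendsto_const_nhds t2 (fun _ => zero_le)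
      fun n => ?_
    -- The first summand is controlled by |θ'| ≤ 1; the second is a fixed g times a factor bounded
    -- by 2 that tends to zero, so dominated convergence applies.
    have hgr : gradient (θ ∘ φ (ns n)) - (fun x => deriv θ (f x) • g x) =
        (fun x => deriv θ (φ (ns n) x) • (gradient (φ (ns n)) - g) x) +
        fun x => (deriv θ (φ (ns n) x) - deriv θ (f x)) • g x := by
      funext x
      simp only [Pi.sub_apply, Pi.add_apply, (hφ (ns n)).gradient_comp hθ]
      module
    have hm := hdc.comp_aestronglyMeasurable ((hφ (ns n)).memLp s).1
    rw [hgr]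
    refine (eLpNorm_add_le (hm.smul (((hφ (ns n)).memLp_gradient s).sub hg).1)
      ((hm.sub (hdc.comp_aestronglyMeasurable hf.1)).smul hg.1) hs).trans ?_
    refine add_le_add (eLpNorm_mono fun x => ?_) le_rfl
    rw [Pi.smul_apply', norm_smul]
    exact mul_le_of_le_one_left (norm_nonneg _) (hθ1 _)

/-- The smooth approximation `√(t² + ε²) - ε` of `|t|`. -/
noncomputable def smoothAbs (ε t : ℝ) : ℝ := √(t ^ 2 + ε ^ 2) - ε

lemma contDiff_smoothAbs {ε : ℝ} (hε : 0 < ε) : ContDiff ℝ ∞ (smoothAbs ε) :=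
  (((contDiff_id.pow 2).add contDiff_const).sqrt fun t => by positivity).sub contDiff_const

lemma smoothAbs_zero {ε : ℝ} (hε : 0 < ε) : smoothAbs ε 0 = 0 := by
  simp [smoothAbs, Real.sqrt_sq hε.le]

lemma deriv_smoothAbs {ε : ℝ} (hε : 0 < ε) (t : ℝ) :
    deriv (smoothAbs ε) t = t / √(t ^ 2 + ε ^ 2) := by
  have h1 : HasDerivAt (fun t : ℝ => t ^ 2 + ε ^ 2) (2 * t) t := by
    simpa using (hasDerivAt_pow 2 t).add_const (ε ^ 2)
  have h2 := (h1.sqrt (by positivity)).sub_const ε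
  rw [show smoothAbs ε = fun t => √(t ^ 2 + ε ^ 2) - ε from rfl, h2.deriv]
  field_simp

lemma abs_le_sqrt_sq_add (ε t : ℝ) : |t| ≤ √(t ^ 2 + ε ^ 2) := by
  rw [← Real.sqrt_sq_eq_abs]
  exact Real.sqrt_le_sqrt (by nlinarith [sq_nonneg ε])

lemma norm_deriv_smoothAbs_le {ε : ℝ} (hε : 0 < ε) (t : ℝ) : ‖deriv (smoothAbs ε) t‖ ≤ 1 := by
  rw [deriv_smoothAbs hε, norm_div, Real.norm_of_nonneg (Real.sqrt_nonneg _)]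
  exact div_le_one_of_le₀ (abs_le_sqrt_sq_add ε t) (Real.sqrt_nonneg _)

lemma norm_smoothAbs_sub_abs_le {ε : ℝ} (hε : 0 < ε) (t : ℝ) : ‖smoothAbs ε t - |t|‖ ≤ ε := by
  have h1 := abs_le_sqrt_sq_add ε t
  have h2 : √(t ^ 2 + ε ^ 2) ≤ |t| + ε := by
    refine Real.sqrt_le_iff.2 ⟨by positivity, ?_⟩
    nlinarith [sq_abs t, abs_nonneg t]
  rw [Real.norm_eq_abs, abs_le, smoothAbs]
  constructor <;> linarith

lemma norm_div_abs_le (t : ℝ) : ‖t / |t|‖ ≤ 1 := by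
  rw [norm_div, Real.norm_eq_abs, Real.norm_eq_abs, abs_abs]
  exact div_self_le_one _

lemma tendsto_deriv_smoothAbs {ε : ℕ → ℝ} (hε : ∀ n, 0 < ε n) (hlim : Tendsto ε atTop (𝓝 0))
    (t : ℝ) : Tendsto (fun n => deriv (smoothAbs (ε n)) t) atTop (𝓝 (t / |t|)) := by
  simp_rw [fun n => deriv_smoothAbs (hε n) t]
  rcases eq_or_ne t 0 with rfl | ht
  · simp
  · have h1 : Tendsto (fun n => √(t ^ 2 + ε n ^ 2)) atTop (𝓝 √(t ^ 2 + 0 ^ 2)) :=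
      (Real.continuous_sqrt.tendsto _).comp ((hlim.pow 2).const_add _)
    rw [zero_pow two_ne_zero, add_zero, Real.sqrt_sq_eq_abs] at h1
    exact tendsto_const_nhds.div h1 (by simpa using ht)

/-- The derivative of `smoothAbs` vanishes at 0 and 0/|0| = 0 in Lean, so the derivatives converge
to t/|t| at every t. Hence the fact that ∇f = 0 almost everywhere on {f = 0} is not required. -/
lemma TestApprox.abs [IsFiniteMeasure (volume.restrict Ω)] (hs : 1 ≤ s) (hs_top : s ≠ ⊤)
    (hf : MemLp f s (volume.restrict Ω)) (hg : MemLp g s (volume.restrict Ω))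
    (h : TestApprox Ω s f g) :
    TestApprox Ω s (fun x => |f x|) (fun x => (f x / |f x|) • g x) := by
  let ε : ℕ → ℝ := fun n => 1 / ((n : ℝ) + 1)
  have hε : ∀ n, 0 < ε n := fun n => by positivity
  have hlim : Tendsto ε atTop (𝓝 0) := tendsto_one_div_add_atTop_nhds_zero_nat
  have hs0 : s ≠ 0 := (zero_lt_one.trans_le hs).ne'
  have hsg : AEStronglyMeasurable (fun x => f x / |f x|) (volume.restrict Ω) :=
    (hf.1.aemeasurable.div hf.1.norm.aemeasurable).aestronglyMeasurable
  have hdm : ∀ n, AEStronglyMeasurable (fun x => deriv (smoothAbs (ε n)) (f x))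
      (volume.restrict Ω) := fun n =>
    ((contDiff_smoothAbs (hε n)).continuous_deriv (by simp)).comp_aestronglyMeasurable hf.1
  refine of_tendsto hs hf.1.norm (hsg.smul hg.1) (F := fun n => smoothAbs (ε n) ∘ f)
    (G := fun n x => deriv (smoothAbs (ε n)) (f x) • g x)
    (fun n => (contDiff_smoothAbs (hε n)).continuous.comp_aestronglyMeasurable hf.1)
    (fun n => (hdm n).smul hg.1)
    (fun n => h.comp hs hs_top hf hg (contDiff_smoothAbs (hε n)) (smoothAbs_zero (hε n))
      (norm_deriv_smoothAbs_le (hε n))) ?_ ?_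
  · have hb : ∀ n, eLpNorm (smoothAbs (ε n) ∘ f - fun x => |f x|) s (volume.restrict Ω) ≤
        volume.restrict Ω Set.univ ^ s.toReal⁻¹ * ENNReal.ofReal (ε n) := fun n =>
      eLpNorm_le_of_ae_bound (.of_forall fun x => norm_smoothAbs_sub_abs_le (hε n) (f x))
    have ht : Tendsto (fun n => volume.restrict Ω Set.univ ^ s.toReal⁻¹ * ENNReal.ofReal (ε n))
        atTop (𝓝 0) := by
      have := ENNReal.Tendsto.const_mul (ENNReal.tendsto_ofReal hlim) (Or.inr
        (ENNReal.rpow_ne_top_of_nonneg (by positivity : 0 ≤ s.toReal⁻¹)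
          (measure_ne_top (volume.restrict Ω) Set.univ)))
      simpa using this
    exact tendsto_of_tendsto_of_tendsto_of_le_of_le tendsto_const_nhds ht (fun _ => zero_le) hb
  · have := tendsto_eLpNorm_smul_zero hs hs_top hg
      (c := fun n x => deriv (smoothAbs (ε n)) (f x) - f x / |f x|) (fun n => (hdm n).sub hsg)
      (fun n x => (norm_sub_le _ _).trans
        (by linarith [norm_deriv_smoothAbs_le (hε n) (f x), norm_div_abs_le (f x)]))
      (.of_forall fun x => by
        simpa using (tendsto_deriv_smoothAbs hε hlim (f x)).sub_const (f x / |f x|))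
    refine this.congr fun n => ?_
    congr 1
    funext x
    simp [sub_smul]

end ChainRule

/-! ### The space W^{1,p_-}_0(Ω), the source functional and comparison -/

section WeakSolutions

open Filter Topology

variable {N : ℕ}

/-- `W^{1,p_-}_0(Ω)` as a linear subspace of `L^p(Ω) × L^p(Ω; ℝ^N)`. -/
def minusSubmodule (Ω : Set (EuclideanSpace ℝ (Fin N))) (p : ℝ≥0∞) :
    Submodule ℝ (LpPair Ω p) where
  carrier := {u | ∀ s : ℝ≥0∞, 1 < s → s < p → TestApprox Ω s u.1 u.2}
  zero_mem' := fun s _ _ => by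
    have h := (TestApprox.of_test (Ω := Ω) (s := s) IsTestFunction.zero).const_smul 0
    rw [zero_smul, zero_smul] at h
    exact h.congr (Lp.coeFn_zero _ _ _).symm (Lp.coeFn_zero _ _ _).symm
  add_mem' := fun {u v} hu hv s hs hsp =>
    ((hu s hs hsp).add hs.le (Lp.aestronglyMeasurable _) (Lp.aestronglyMeasurable _)
      (Lp.aestronglyMeasurable _) (Lp.aestronglyMeasurable _) (hv s hs hsp)).congr
      (Lp.coeFn_add _ _).symm (Lp.coeFn_add _ _).symm
  smul_mem' := fun c u hu s hs hsp =>
    ((hu s hs hsp).const_smul c).congr (Lp.coeFn_smul _ _).symm (Lp.coeFn_smul _ _).symm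

variable {Ω : Set (EuclideanSpace ℝ (Fin N))} {p p' : ℝ≥0∞}

/-- If `u` lies in `W^{1,p_-}_0(Ω)`, then so does its positive part. -/
lemma exists_positivePart_mem [IsFiniteMeasure (volume.restrict Ω)] {u : LpPair Ω p}
    (hu : u ∈ minusSubmodule Ω p) : ∃ v ∈ minusSubmodule Ω p,
      (∀ᵐ x ∂(volume.restrict Ω), v.1 x = (u.1 x + |u.1 x|) / 2) ∧
      ∀ᵐ x ∂(volume.restrict Ω), v.2 x = ((1 + u.1 x / |u.1 x|) / 2) • u.2 x := by
  have hsg : AEStronglyMeasurable (fun x => u.1 x / |u.1 x|) (volume.restrict Ω) :=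
    ((Lp.aestronglyMeasurable u.1).aemeasurable.div
      (Lp.aestronglyMeasurable u.1).norm.aemeasurable).aestronglyMeasurable
  have m1 : MemLp (fun x => |u.1 x|) p (volume.restrict Ω) := (Lp.memLp u.1).norm
  have m2 : MemLp (fun x => (u.1 x / |u.1 x|) • u.2 x) p (volume.restrict Ω) :=
    (Lp.memLp u.2).mono (hsg.smul (Lp.aestronglyMeasurable u.2)) (.of_forall fun x => by
      rw [norm_smul]
      exact mul_le_of_le_one_left (norm_nonneg _) (norm_div_abs_le _))
  let a : LpPair Ω p := (m1.toLp, m2.toLp)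
  have ha : a ∈ minusSubmodule Ω p := fun s hs hsp =>
    ((hu s hs hsp).abs hs.le hsp.ne_top ((Lp.memLp u.1).mono_exponent hsp.le)
      ((Lp.memLp u.2).mono_exponent hsp.le)).congr m1.coeFn_toLp.symm m2.coeFn_toLp.symm
  -- Uses u⁺ = (u + |u|)/2. On {u = 0} the gradient formula carries the factor 1/2, by the value
  -- 0/|0| = 0.
  refine ⟨(1 / 2 : ℝ) • (u + a), Submodule.smul_mem _ _ (Submodule.add_mem _ hu ha), ?_, ?_⟩
  · filter_upwards [Lp.coeFn_smul (1 / 2 : ℝ) (u.1 + a.1), Lp.coeFn_add u.1 a.1, m1.coeFn_toLp]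
      with x h1 h2 h3
    rw [Prod.smul_fst, Prod.fst_add, h1, Pi.smul_apply, h2, Pi.add_apply, h3, smul_eq_mul]
    ring
  · filter_upwards [Lp.coeFn_smul (1 / 2 : ℝ) (u.2 + a.2), Lp.coeFn_add u.2 a.2, m2.coeFn_toLp]
      with x h1 h2 h3
    rw [Prod.smul_snd, Prod.snd_add, h1, Pi.smul_apply, h2, Pi.add_apply, h3]
    module

variable [Fact (1 ≤ p)] [Fact (1 ≤ p')]

lemma mem_minusSubmodule_iff [IsFiniteMeasure (volume.restrict Ω)] (hΩ : IsOpen Ω) (hp : 1 < p)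
    {u : LpPair Ω p} : u ∈ minusSubmodule Ω p ↔ u ∈ W1pMinus Ω p :=
  (mem_W1pMinus_iff hΩ hp).symm

lemma tendsto_eLpNorm_sub_of_lt [IsFiniteMeasure (volume.restrict Ω)] {F : Type*}
    [NormedAddCommGroup F] {s : ℝ≥0∞} (hs : 1 < s) (hsp : s < p) (hp_top : p ≠ ⊤)
    {a : ℕ → Lp F p (volume.restrict Ω)} {b : Lp F p (volume.restrict Ω)}
    (h : Tendsto a atTop (𝓝 b)) :
    Tendsto (fun n => eLpNorm (⇑(a n) - ⇑b) s (volume.restrict Ω)) atTop (𝓝 0) := by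
  have ht := one_lt_toReal_of_ne_top hs hsp.ne_top
  have he0 : 0 ≤ 1 / s.toReal - 1 / p.toReal :=
    sub_nonneg.2 (one_div_le_one_div_of_le (by linarith) (ENNReal.toReal_mono hp_top hsp.le))
  have h1 := ENNReal.Tendsto.mul_const ((Lp.tendsto_Lp_iff_tendsto_eLpNorm' a b).1 h) (Or.inr
    (ENNReal.rpow_ne_top_of_nonneg he0 (measure_ne_top (volume.restrict Ω) Set.univ)))
  rw [zero_mul] at h1
  exact tendsto_of_tendsto_of_tendsto_of_le_of_le tendsto_const_nhds h1 (fun _ => zero_le)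
    fun n => eLpNorm_le_eLpNorm_mul_rpow_measure_univ hsp.le
      ((Lp.aestronglyMeasurable _).sub (Lp.aestronglyMeasurable _))

/-- Convergence in L^p implies convergence in L^s for s < p because Ω has finite measure, and
approximability by test functions is a closed condition in L^s. -/
lemma isClosed_minusSubmodule [IsFiniteMeasure (volume.restrict Ω)] (hp_top : p ≠ ⊤) :
    IsClosed (minusSubmodule Ω p : Set (LpPair Ω p)) := by
  refine IsSeqClosed.isClosed fun u v hu huv s hs hsp => ?_
  exact TestApprox.of_tendsto hs.le (Lp.aestronglyMeasurable _) (Lp.aestronglyMeasurable _)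
    (fun n => Lp.aestronglyMeasurable (u n).1) (fun n => Lp.aestronglyMeasurable (u n).2)
    (fun n => hu n s hs hsp)
    (tendsto_eLpNorm_sub_of_lt hs hsp hp_top ((continuous_fst.tendsto v).comp huv))
    (tendsto_eLpNorm_sub_of_lt hs hsp hp_top ((continuous_snd.tendsto v).comp huv))

/-- The functional `v ↦ ∫ (z v + Z · ∇v)`, as a continuous linear function of `(z, Z)`. -/
noncomputable def sourceFunctional (Ω : Set (EuclideanSpace ℝ (Fin N))) (p p' : ℝ≥0∞)
    [Fact (1 ≤ p)] [Fact (1 ≤ p')] [ENNReal.HolderConjugate p' p] :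
    LpPair Ω p' →L[ℝ] LpPair Ω p →L[ℝ] ℝ :=
  ((ContinuousLinearMap.fst ℝ _ _).precomp ℝ ∘L
    (ContinuousLinearMap.mul ℝ ℝ).lpPairing (volume.restrict Ω) p' p) ∘L
      ContinuousLinearMap.fst ℝ _ _ +
  ((ContinuousLinearMap.snd ℝ _ _).precomp ℝ ∘L
    (innerSL ℝ).lpPairing (volume.restrict Ω) p' p) ∘L ContinuousLinearMap.snd ℝ _ _

lemma sourceFunctional_apply [ENNReal.HolderConjugate p' p] (d : LpPair Ω p') (v : LpPair Ω p) :
    sourceFunctional Ω p p' d v =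
      ∫ x in Ω, (d.1 x * v.1 x + inner ℝ (d.2 x) (v.2 x)) := by
  have h1 : Integrable (fun x => d.1 x * v.1 x) (volume.restrict Ω) :=
    memLp_one_iff_integrable.1 ((ContinuousLinearMap.mul ℝ ℝ).memLp_of_bilin 1
      (Lp.memLp d.1) (Lp.memLp v.1))
  have h2 : Integrable (fun x => inner ℝ (d.2 x) (v.2 x)) (volume.restrict Ω) :=
    memLp_one_iff_integrable.1 ((innerSL ℝ).memLp_of_bilin 1 (Lp.memLp d.2) (Lp.memLp v.2))
  rw [integral_add h1 h2]
  exact congrArg₂ (fun a b : ℝ => a + b) (ContinuousLinearMap.lpPairing_eq_integral _ d.1 v.1)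
    (ContinuousLinearMap.lpPairing_eq_integral _ d.2 v.2)

/-- The field Z is only required to agree almost everywhere with the class `d.2`, so that the
literal zero field of part (b) is covered. -/
lemma isWeakSolution_iff_solvesFlux [IsFiniteMeasure (volume.restrict Ω)] (hΩ : IsOpen Ω)
    (hp : 1 < p) [ENNReal.HolderConjugate p' p] (d : LpPair Ω p')
    {Z : EuclideanSpace ℝ (Fin N) → EuclideanSpace ℝ (Fin N)}
    (hZ : d.2 =ᵐ[volume.restrict Ω] Z) {w : LpPair Ω p} :
    IsWeakSolution Ω p d.1 Z w ↔ SolvesFlux (minusSubmodule Ω p) (sourceFunctional Ω p p' d) w := by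
  have hl : ∀ v : LpPair Ω p,
      ∫ x in Ω, ‖w.2 x‖ ^ (p.toReal - 2) * inner ℝ (w.2 x) (v.2 x) = fluxForm w.2 v.2 := by
    intro v
    simp only [fluxForm, powFlux, real_inner_smul_left]
  have hr : ∀ v : LpPair Ω p, ∫ x in Ω, (d.1 x * v.1 x + inner ℝ (Z x) (v.2 x)) =
      sourceFunctional Ω p p' d v := by
    intro v
    rw [sourceFunctional_apply]
    refine integral_congr_ae ?_
    filter_upwards [hZ] with x hx
    rw [hx]
  simp only [IsWeakSolution, SolvesFlux, hl, hr, mem_minusSubmodule_iff hΩ hp]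

lemma inner_powFlux_sub_nonneg {q : ℝ} (hq : 1 < q) {V : Type*} [NormedAddCommGroup V]
    [InnerProductSpace ℝ V] (a b : V) : 0 ≤ inner ℝ (powFlux q a - powFlux q b) (a - b) := by
  have := (powDefect_nonneg hq a b).trans (powDefect_le hq a b)
  exact nonneg_of_mul_nonneg_right this (by positivity)

lemma eq_of_inner_powFlux_sub_eq_zero {q : ℝ} (hq : 1 < q) {V : Type*} [NormedAddCommGroup V]
    [InnerProductSpace ℝ V] {a b : V} (h : inner ℝ (powFlux q a - powFlux q b) (a - b) = 0) :
    a = b := by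
  have := powDefect_le hq a b
  rw [h, mul_zero] at this
  exact (powDefect_nonneg_and_eq hq a b).2 (le_antisymm this (powDefect_nonneg hq a b))

/-- Comparison principle. -/
theorem SolvesFlux.ae_le [IsFiniteMeasure (volume.restrict Ω)]
    (hp : 1 < p) (hp_top : p ≠ ⊤) {K : ℝ} (hK : ∀ w ∈ minusSubmodule Ω p, ‖w‖ ≤ K * ‖w.2‖)
    {ℓ₁ ℓ₂ : LpPair Ω p →L[ℝ] ℝ} {w₁ w₂ : LpPair Ω p}
    (hℓ : ∀ v : LpPair Ω p, (∀ᵐ x ∂(volume.restrict Ω), 0 ≤ v.1 x) → ℓ₁ v ≤ ℓ₂ v)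
    (h₁ : SolvesFlux (minusSubmodule Ω p) ℓ₁ w₁) (h₂ : SolvesFlux (minusSubmodule Ω p) ℓ₂ w₂) :
    ∀ᵐ x ∂(volume.restrict Ω), w₁.1 x ≤ w₂.1 x := by
  have hq := one_lt_toReal_of_ne_top hp hp_top
  -- The test function is (w₁ - w₂)⁺, nonnegative and admissible in both equations.
  obtain ⟨v, hv, hv1, hv2⟩ := exists_positivePart_mem (Submodule.sub_mem _ h₁.1 h₂.1)
  have hv0 : ∀ᵐ x ∂(volume.restrict Ω), 0 ≤ v.1 x := by
    filter_upwards [hv1] with x hx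
    rw [hx]
    linarith [neg_abs_le ((w₁ - w₂).1 x)]
  have hle : fluxForm w₁.2 v.2 - fluxForm w₂.2 v.2 ≤ 0 := by
    rw [h₁.2 v hv, h₂.2 v hv]
    linarith [hℓ v hv0]
  have i1 := integrable_inner_powFlux hp hp_top w₁.2 v.2
  have i2 := integrable_inner_powFlux hp hp_top w₂.2 v.2
  rw [fluxForm, fluxForm, ← integral_sub i1 i2] at hle
  have hform : ∀ᵐ x ∂(volume.restrict Ω),
      inner ℝ (powFlux p.toReal (w₁.2 x)) (v.2 x) - inner ℝ (powFlux p.toReal (w₂.2 x)) (v.2 x) =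
        (1 + (w₁ - w₂).1 x / |(w₁ - w₂).1 x|) / 2 *
          inner ℝ (powFlux p.toReal (w₁.2 x) - powFlux p.toReal (w₂.2 x)) (w₁.2 x - w₂.2 x) := by
    filter_upwards [hv2, Lp.coeFn_sub w₁.2 w₂.2] with x hx hx'
    rw [hx, Prod.snd_sub, hx', Pi.sub_apply, ← inner_sub_left, real_inner_smul_right]
  have hnn : 0 ≤ᵐ[volume.restrict Ω] fun x =>
      inner ℝ (powFlux p.toReal (w₁.2 x)) (v.2 x) -
        inner ℝ (powFlux p.toReal (w₂.2 x)) (v.2 x) := by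
    filter_upwards [hform] with x hx
    rw [hx]
    refine mul_nonneg ?_ (inner_powFlux_sub_nonneg hq _ _)
    linarith [neg_le_of_abs_le (norm_div_abs_le ((w₁ - w₂).1 x))]
  have hzero := (integral_eq_zero_iff_of_nonneg_ae hnn (i1.sub i2)).1
    (le_antisymm hle (integral_nonneg_of_ae hnn))
  -- A nonnegative integrand with nonpositive integral vanishes almost everywhere. At each such
  -- point either the factor in front of ∇(w₁ - w₂) is zero or strict monotonicity gives ∇w₁ = ∇w₂;
  -- in both cases ∇v = 0.
  have hvz : v.2 = 0 := by
    refine Lp.ext ?_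
    filter_upwards [hzero, hform, hv2, Lp.coeFn_sub w₁.2 w₂.2,
      Lp.coeFn_zero (EuclideanSpace ℝ (Fin N)) p (volume.restrict Ω)] with x h0 hf h2 hs hz
    rw [hz, h2, Pi.zero_apply]
    rw [hf, Pi.zero_apply] at h0
    rcases mul_eq_zero.1 h0 with h | h
    · rw [h, zero_smul]
    · rw [Prod.snd_sub, hs, Pi.sub_apply, eq_of_inner_powFlux_sub_eq_zero hq h, sub_self,
        smul_zero]
  have hv : v = 0 := by
    have := hK v hv
    rw [hvz, norm_zero, mul_zero] at this
    exact norm_le_zero_iff.1 this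
  rw [hv] at hv1
  filter_upwards [hv1, Lp.coeFn_sub w₁.1 w₂.1, Lp.coeFn_zero ℝ p (volume.restrict Ω)]
    with x h1 h2 h3
  rw [Prod.fst_zero, h3, Pi.zero_apply, Prod.fst_sub, h2, Pi.sub_apply] at h1
  linarith [le_abs_self (w₁.1 x - w₂.1 x), abs_nonneg (w₁.1 x - w₂.1 x)]

end WeakSolutions

/-! ### Assembly of the theorem -/

theorem theorem7p1 {N : ℕ} (hN : 0 < N) (Ω : Set (EuclideanSpace ℝ (Fin N)))
    (hΩ : IsOpen Ω) (hΩb : Bornology.IsBounded Ω)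
    (p p' : ℝ≥0∞) [Fact (1 ≤ p)] [Fact (1 ≤ p')] (hp : 1 < p) (hp_top : p ≠ ⊤)
    (hpp' : p⁻¹ + p'⁻¹ = 1) :
    -- (a) existence and uniqueness
    (∀ (z : Lp ℝ p' (volume.restrict Ω))
        (Z : Lp (EuclideanSpace ℝ (Fin N)) p' (volume.restrict Ω)),
      ∃! w : LpPair Ω p, IsWeakSolution Ω p z Z w) ∧
    -- (a) continuity of the solution operator into `W^{1,p}(Ω)`
    (∃ S : Lp ℝ p' (volume.restrict Ω) × Lp (EuclideanSpace ℝ (Fin N)) p' (volume.restrict Ω) →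
        W1p Ω p,
      (∀ d, IsWeakSolution Ω p d.1 d.2 (S d)) ∧ Continuous S) ∧
    -- (b) comparison principle
    (∀ (z₁ z₂ : Lp ℝ p' (volume.restrict Ω)) (w₁ w₂ : LpPair Ω p),
      (∀ᵐ x ∂(volume.restrict Ω), z₁ x ≤ z₂ x) →
      IsWeakSolution Ω p z₁ (fun _ => 0) w₁ → IsWeakSolution Ω p z₂ (fun _ => 0) w₂ →
      ∀ᵐ x ∂(volume.restrict Ω), w₁.1 x ≤ w₂.1 x) := by
  have : IsFiniteMeasure (volume.restrict Ω) := ⟨by simpa using hΩb.measure_lt_top⟩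
  have : ENNReal.HolderConjugate p' p := ⟨by rw [add_comm, hpp', inv_one]⟩
  obtain ⟨K, hK0, hK⟩ : ∃ K : ℝ, 0 < K ∧ ∀ u ∈ minusSubmodule Ω p, ‖u‖ ≤ K * ‖u.2‖ :=
    exists_norm_le_of_testApprox hN hΩb hp hp_top
  have hX := isClosed_minusSubmodule (Ω := Ω) hp_top
  have hiff : ∀ (d : LpPair Ω p') (w : LpPair Ω p), IsWeakSolution Ω p d.1 d.2 w ↔
      SolvesFlux (minusSubmodule Ω p) (sourceFunctional Ω p p' d) w := fun d w =>
    isWeakSolution_iff_solvesFlux hΩ hp d (ae_eq_refl _)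
  have hex : ∀ d : LpPair Ω p', ∃ w : LpPair Ω p, IsWeakSolution Ω p d.1 d.2 w := by
    intro d
    obtain ⟨w, hw⟩ := exists_solvesFlux hp hp_top hX hK0 hK (sourceFunctional Ω p p' d)
    exact ⟨w, (hiff d w).2 hw⟩
  refine ⟨fun z Z => ?_, ?_, fun z₁ z₂ w₁ w₂ hz h₁ h₂ => ?_⟩
  · obtain ⟨w, hw⟩ := hex (z, Z)
    refine ⟨w, hw, fun w' hw' => ?_⟩
    exact SolvesFlux.unique hp hp_top hK0 hK ((hiff (z, Z) w).1 hw) ((hiff (z, Z) w').1 hw')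
  · choose S hS using hex
    refine ⟨fun d => ⟨S d, (hS d).1.1⟩, hS, Continuous.subtype_mk ?_ _⟩
    refine Metric.continuous_iff.2 fun d ε hε => ?_
    -- Stability is measured in the operator norm of the functional; continuity of (z, Z) ↦ ℓ
    -- converts it into a neighbourhood of the data.
    obtain ⟨δ, hδ, h⟩ := SolvesFlux.stability hp hp_top hK0 hK (sourceFunctional Ω p p' d) hε
    obtain ⟨η, hη, hc⟩ :=
      Metric.continuous_iff.1 (sourceFunctional Ω p p').continuous d δ hδ
    refine ⟨η, hη, fun d' hd' => ?_⟩
    rw [dist_eq_norm]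
    refine h (sourceFunctional Ω p p' d') ?_ _ _ ((hiff d _).1 (hS d)) ((hiff d' _).1 (hS d'))
    rw [← dist_eq_norm]
    exact hc d' hd'
  · have h0 := Lp.coeFn_zero (EuclideanSpace ℝ (Fin N)) p' (volume.restrict Ω)
    refine SolvesFlux.ae_le hp hp_top hK (ℓ₁ := sourceFunctional Ω p p' (z₁, 0))
      (ℓ₂ := sourceFunctional Ω p p' (z₂, 0)) (fun v hv => ?_)
      ((isWeakSolution_iff_solvesFlux hΩ hp (z₁, 0) h0).1 h₁)
      ((isWeakSolution_iff_solvesFlux hΩ hp (z₂, 0) h0).1 h₂)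
    rw [← sub_nonneg, ← sub_apply, ← map_sub, sourceFunctional_apply]
    refine integral_nonneg_of_ae ?_
    filter_upwards [hv, hz, h0, Lp.coeFn_sub z₂ z₁] with x hx hzx h0x hs
    rw [Prod.mk_sub_mk, sub_self, h0x, hs, Pi.sub_apply]
    simpa using mul_nonneg (sub_nonneg.2 hzx) hx
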